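/- **Conventions.** All Hilbert spaces are finite-dimensional and $\log=\log_2$, with $\log 0=-\infty$, $\log\infty=\infty$. For a bipartite space $\mathcal H_A\otimes\mathcal H_B$, $\mathrm{Sep}_{A:B}$ is the set of separable states (convex combinations of product states) and $\overline{\mathrm{Sep}}_{A:B}=\{t\sigma: 0\le t\le 1,\ \sigma\in\mathrm{Sep}_{A:B}\}$. For positive semidefinite $\rho,\sigma$ put $$\Omega(\rho,\sigma)=\inf\{\gamma:\ \rho\le\eta\sigma\le\gamma\rho,\ \eta,\gamma\ge 0\}\ \text{ if } \mathrm{supp}\,\rho=\mathrm{supp}\,\sigma,\qquad \Omega(\rho,\sigma)=\infty\ \text{ otherwise,}$$ let $D_\Omega=\log\Omega$ be the Hilbert projective metric, and for a set $\mathcal F$ of operators put $D_{\Omega,\mathcal F}(\rho)=\inf_{\sigma\in\mathcal F}D_\Omega(\rho,\sigma)$ and $\hat\Omega_{\mathcal F}(\rho)=\inf_{\sigma\in\mathcal F}\Omega(\sigma,\rho)$. A quantum instrument is a finite family $\{\mathcal E_i\}$ of completely positive trace-nonincreasing maps whose sum is a channel. For $\delta\ge0$, an instrument from $A:B$ to $A':B'$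 is $\delta$-approximately nonentangling ($\mathcal{NE}_\delta$) if $D_{\Omega,\overline{\mathrm{Sep}}_{A':B'}}(\mathcal E_i(\sigma))\le\delta$ for all $i$ and all $\sigma\in\mathrm{Sep}_{A:B}$. Let $\Psi_m$ be the maximally entangled state on $\mathbb C^m\otimes\mathbb C^m$ and $F(\rho,\sigma)=\|\sqrt\rho\sqrt\sigma\|_1$. For a state $\rho$ on $\mathcal H_A\otimes\mathcal H_B$ define $E^{(m),\mathcal{NE}_\delta}_{d,err,p}(\rho)\in[-\infty,\infty]$ as the supremum of all limits $\lim_{n\to\infty}-\frac1n\log\epsilon_n$ over sequences $\epsilon_n\ge0$ for which this limit exists in $[-\infty,\infty]$ and such that for each $n\ge1$ some element $\mathcal E_i$ of some $\mathcal{NE}_\delta$ instrument from $A^{\otimes n}:B^{\otimes n}$ to $\mathbb C^m:\mathbb C^m$ satisfies $$\mathrm{tr}\,\mathcal E_i(\rho^{\otimes n})>0,\qquad F\Big(\frac{\mathcal E_i(\rho^{\otimes n})}{\mathrm{tr}\,\mathcal E_i(\rho^{\otimes n})},\Psi_m\Big)\ge1-\epsilon_n .$$ The asymptotic error exponent of probabilistic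 entanglement distillation under $\mathcal{NE}_\delta$ is $E^{\mathcal{NE}_\delta}_{d,err,p}(\rho)=\lim_{m\to\infty}E^{(m),\mathcal{NE}_\delta}_{d,err,p}(\rho)$. **Theorem.** Let $\rho$ be a bipartite state and $\delta\ge0$. Then the limit $$\hat D^{reg}_{\Omega,\mathrm{Sep}}(\rho)=\lim_{n\to\infty}\frac1n\log\hat\Omega_{\mathrm{Sep}}(\rho^{\otimes n})$$ exists in $[-\infty,\infty]$, where $\mathrm{Sep}$ refers to the cut $A^{\otimes n}:B^{\otimes n}$, and $$E^{(m),\mathcal{NE}_\delta}_{d,err,p}(\rho)=\hat D^{reg}_{\Omega,\mathrm{Sep}}(\rho)\quad\text{for every integer } m\ge2.$$ Consequently the limit defining $E^{\mathcal{NE}_\delta}_{d,err,p}(\rho)$ exists and $E^{\mathcal{NE}_\delta}_{d,err,p}(\rho)=\hat D^{reg}_{\Omega,\mathrm{Sep}}(\rho)$. -/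

import Mathlib

open Filter Topology Matrix
open scoped NNReal ENNReal Kronecker ComplexOrder

noncomputable section

namespace ProbDistill

/-! Operators on the Hilbert space `ℂ^ι` are complex matrices indexed by the finite type `ι`;
the bipartite space `ℂ^a ⊗ ℂ^b` is indexed by `a × b`. All logarithms are to base two. -/

/-- The base two logarithm with `log 0 = -∞` and `log ∞ = ∞`. -/
def log2 (x : ℝ≥0∞) : EReal := ENNReal.log x / ((Real.log 2 : ℝ) : EReal)

section States

variable {ι κ : Type*} [Fintype ι] [Fintype κ]

/-- Quantum states: positive semidefinite operators of trace one. -/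
def IsState (ρ : Matrix ι ι ℂ) : Prop := ρ.PosSemidef ∧ ρ.trace = 1

/-- The separable states on `ℂ^ι ⊗ ℂ^κ`: convex combinations of product states. -/
def Sep (ι κ : Type*) [Fintype ι] [Fintype κ] : Set (Matrix (ι × κ) (ι × κ) ℂ) :=
  convexHull ℝ {X | ∃ (α : Matrix ι ι ℂ) (β : Matrix κ κ ℂ),
    IsState α ∧ IsState β ∧ X = α ⊗ₖ β}

/-- The separable substates: separable states rescaled to trace at most one. -/
def SubSep (ι κ : Type*) [Fintype ι] [Fintype κ] : Set (Matrix (ι × κ) (ι × κ) ℂ) :=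
  {X | ∃ t : ℝ, 0 ≤ t ∧ t ≤ 1 ∧ ∃ σ ∈ Sep ι κ, X = t • σ}

end States

section HilbertMetric

variable {ι : Type*} [Fintype ι] [DecidableEq ι]

/-- The support of an operator: the orthogonal complement of its kernel. -/
def supp (X : Matrix ι ι ℂ) : Submodule ℂ (EuclideanSpace ℂ ι) :=
  (LinearMap.ker (Matrix.toEuclideanLin X))ᗮ

open Classical in
/-- `Ω(ρ, σ) = inf {γ | ρ ≤ η σ ≤ γ ρ, η, γ ≥ 0}` if the supports agree, and `∞` otherwise. -/
def Omega (ρ σ : Matrix ι ι ℂ) : ℝ≥0∞ :=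
  if supp ρ = supp σ then
    ⨅ (γ : ℝ≥0) (η : ℝ≥0) (_ : ((η : ℝ) • σ - ρ).PosSemidef)
      (_ : ((γ : ℝ) • ρ - (η : ℝ) • σ).PosSemidef), (γ : ℝ≥0∞)
  else ⊤

/-- The Hilbert projective metric `D_Ω(ρ, σ) = log Ω(ρ, σ)`. -/
def DOmega (ρ σ : Matrix ι ι ℂ) : EReal := log2 (Omega ρ σ)

/-- `D_{Ω,F}(ρ)`, the Hilbert projective metric between `ρ` and the set `F`. -/
def DOmegaSet (F : Set (Matrix ι ι ℂ)) (ρ : Matrix ι ι ℂ) : EReal :=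
  ⨅ σ ∈ F, DOmega ρ σ

/-- The reversed quantity `Ω̂_F(ρ) = inf_{σ ∈ F} Ω(σ, ρ)`. -/
def OmegaHat (F : Set (Matrix ι ι ℂ)) (ρ : Matrix ι ι ℂ) : ℝ≥0∞ :=
  ⨅ σ ∈ F, Omega σ ρ

end HilbertMetric

section Fidelity

variable {ι : Type*} [Fintype ι] [DecidableEq ι]

/-- The square root of a positive semidefinite matrix, by functional calculus. -/
def msqrt (A : Matrix ι ι ℂ) : Matrix ι ι ℂ := cfc Real.sqrt A

/-- The trace norm `‖A‖₁ = tr √(A† A)`. -/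
def traceNorm (A : Matrix ι ι ℂ) : ℝ := (msqrt (Aᴴ * A)).trace.re

/-- The fidelity `F(ρ, σ) = ‖√ρ √σ‖₁`. -/
def fidelity (ρ σ : Matrix ι ι ℂ) : ℝ := traceNorm (msqrt ρ * msqrt σ)

end Fidelity

/-- The vector `m^{-1/2} ∑ᵢ |ii⟩`. -/
def maxEntVec (m : ℕ) : Fin m × Fin m → ℂ :=
  fun x => if x.1 = x.2 then ((1 / Real.sqrt m : ℝ) : ℂ) else 0

/-- The maximally entangled state `Ψ_m` on `ℂ^m ⊗ ℂ^m`. -/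
def maxEnt (m : ℕ) : Matrix (Fin m × Fin m) (Fin m × Fin m) ℂ :=
  vecMulVec (maxEntVec m) (star (maxEntVec m))

section Maps

variable {ι κ : Type*} [Fintype ι] [Fintype κ]

/-- The map `id_k ⊗ E`, which applies `E` to every block of a `k × k` block matrix. -/
def ampliation (k : ℕ) (E : Matrix ι ι ℂ →ₗ[ℂ] Matrix κ κ ℂ)
    (X : Matrix (Fin k × ι) (Fin k × ι) ℂ) : Matrix (Fin k × κ) (Fin k × κ) ℂ :=
  Matrix.of fun s t => E (Matrix.of fun x y => X (s.1, x) (t.1, y)) s.2 t.2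

/-- Complete positivity: `id_k ⊗ E` is a positive map for every `k`. -/
def IsCP (E : Matrix ι ι ℂ →ₗ[ℂ] Matrix κ κ ℂ) : Prop :=
  ∀ (k : ℕ) (X : Matrix (Fin k × ι) (Fin k × ι) ℂ), X.PosSemidef → (ampliation k E X).PosSemidef

/-- Subchannels: completely positive, trace nonincreasing maps. -/
def IsSubchannel (E : Matrix ι ι ℂ →ₗ[ℂ] Matrix κ κ ℂ) : Prop :=
  IsCP E ∧ ∀ X : Matrix ι ι ℂ, X.PosSemidef → (E X).trace.re ≤ X.trace.re

/-- Channels: completely positive, trace preserving maps. -/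
def IsChannel (E : Matrix ι ι ℂ →ₗ[ℂ] Matrix κ κ ℂ) : Prop :=
  IsCP E ∧ ∀ X : Matrix ι ι ℂ, (E X).trace = X.trace

/-- Quantum instruments: finite families of subchannels that sum to a channel. -/
def IsInstrument {k : ℕ} (E : Fin k → (Matrix ι ι ℂ →ₗ[ℂ] Matrix κ κ ℂ)) : Prop :=
  (∀ i, IsSubchannel (E i)) ∧ IsChannel (∑ i, E i)

end Maps

/-- `δ`-approximately nonentangling instruments from `A : B` to `A' : B'`: every element maps
every separable state to within Hilbert projective distance `δ` of the separable substates. -/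
def IsNE {a b a' b' : Type*} [Fintype a] [Fintype b] [Fintype a'] [Fintype b']
    [DecidableEq a'] [DecidableEq b'] (δ : ℝ) {k : ℕ}
    (E : Fin k → (Matrix (a × b) (a × b) ℂ →ₗ[ℂ] Matrix (a' × b') (a' × b') ℂ)) : Prop :=
  IsInstrument E ∧ ∀ i, ∀ σ ∈ Sep a b, DOmegaSet (SubSep a' b') (E i σ) ≤ (δ : EReal)

section Exponents

variable {a b : Type*} [Fintype a] [DecidableEq a] [Fintype b] [DecidableEq b]

/-- `ρ^{⊗n}` as an operator on the bipartite space `A^{⊗n} ⊗ B^{⊗n}`. -/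
def tensorPow (ρ : Matrix (a × b) (a × b) ℂ) (n : ℕ) :
    Matrix ((Fin n → a) × (Fin n → b)) ((Fin n → a) × (Fin n → b)) ℂ :=
  Matrix.of fun x y => ∏ i, ρ (x.1 i, x.2 i) (y.1 i, y.2 i)

/-- Some element of some `δ`-approximately nonentangling instrument succeeds on `ρ^{⊗n}` with
positive probability, and its normalized output has fidelity at least `1 - ε` with `Ψ_m`. -/
def Distills (δ : ℝ) (m : ℕ) (ρ : Matrix (a × b) (a × b) ℂ) (n : ℕ) (ε : ℝ≥0) : Prop :=
  ∃ (k : ℕ) (E : Fin k → (Matrix ((Fin n → a) × (Fin n → b)) ((Fin n → a) × (Fin n → b)) ℂ →ₗ[ℂ]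
      Matrix (Fin m × Fin m) (Fin m × Fin m) ℂ)) (i : Fin k),
    IsNE δ E ∧ 0 < (E i (tensorPow ρ n)).trace.re ∧
    1 - (ε : ℝ) ≤ fidelity
      (((E i (tensorPow ρ n)).trace)⁻¹ • E i (tensorPow ρ n)) (maxEnt m)

/-- The probabilistic distillation exponent with target `Ψ_m`: the supremum of
`lim_n -(1/n) log ε_n` over the error sequences `ε_n` that can be achieved. -/
def distExponentAt (δ : ℝ) (m : ℕ) (ρ : Matrix (a × b) (a × b) ℂ) : EReal :=
  sSup {L : EReal | ∃ ε : ℕ → ℝ≥0, (∀ n, 1 ≤ n → Distills δ m ρ n (ε n)) ∧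
    Tendsto (fun n : ℕ => -(((1 / n : ℝ) : EReal) * log2 (ε n))) atTop (𝓝 L)}

/-- The asymptotic error exponent of probabilistic entanglement distillation. -/
def distExponent (δ : ℝ) (ρ : Matrix (a × b) (a × b) ℂ) : EReal :=
  limUnder atTop fun m : ℕ => distExponentAt δ m ρ

/-- The sequence `(1/n) log Ω̂_Sep(ρ^{⊗n})`. -/
def regSeq (ρ : Matrix (a × b) (a × b) ℂ) (n : ℕ) : EReal :=
  ((1 / n : ℝ) : EReal) * log2 (OmegaHat (Sep (Fin n → a) (Fin n → b)) (tensorPow ρ n))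

/-- The regularized quantity `lim_n (1/n) log Ω̂_Sep(ρ^{⊗n})`. -/
def DOmegaHatReg (ρ : Matrix (a × b) (a × b) ℂ) : EReal :=
  limUnder atTop (regSeq ρ)

end Exponents

end ProbDistill

end

/-!
Write `Ω n` for `Ω̂_Sep(ρ^{⊗n})`. The exponent is computed by matching, up to constants that depend
on `m` and `δ` only, the smallest error that is achievable on `n` copies with `1 / Ω n`.

*The limit.* Tensor products of separable states give `Ω (n + k) ≤ Ω n * Ω k`
(`omegaHat_tensorPow_add_le`), and tracing out copies gives `Ω n ≤ Ω (n + k)`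
(`omegaHat_tensorPow_le_add`). So the `Ω n` with `n ≥ 1` are all finite or all infinite, and in the
finite case Fekete's lemma yields the limit of `(1 / n) log Ω n` (`exists_tendsto_regSeq`).

*Converse.* Let `p` be the weight of an operator on `Ψ_m` and `q` the rest of its trace. A separable
state has `p ≤ 1 / m`, so the output `E σ` on a separable input `σ` has `p ≤ 2 ^ (δ + 1) q`
(`overlap_le_of_dOmegaSet_le`). If `σ ≤ η ρ^{⊗n} ≤ γ σ`, applying the positive map `E` shows
`p ≤ γ 2 ^ (δ + 1) q` for the output on `ρ^{⊗n}`. As the fidelity with `Ψ_m` is `√(p / (p + q))`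
(`fidelity_normalize_maxEnt`), the error is at least of order `1 / γ` (`Distills.one_le`).

*Achievability.* If `γ < Ω n`, Hahn-Banach separation, which uses that the set of separable states
is compact, provides positive functionals `A`, `B` with `γ A ≤ B` on separable states and
`B ρ^{⊗n} < A ρ^{⊗n}` (`exists_dual_witness`). For a separable state `τ` and `C > 0` such that
`Ψ_m + C τ` is in the separable cone (`exists_add_maxEnt_mem_sepCone`), the map
`X ↦ γ A(X) Ψ_m + C B(X) τ`, rescaled, is an element of an instrument that preserves separability
(`exists_instrument`), and its error on `ρ^{⊗n}` is at most `C / γ` (`exists_distills`).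
-/

noncomputable section

namespace ProbDistill

open scoped MatrixOrder Pointwise

/-! ### Positive semidefinite matrices -/

section Psd
variable {ι κ : Type*} [Fintype ι] [Fintype κ]

/-- The operator inequality `P ≤ tr(P) 1`. -/
lemma posSemidef_trace_smul_one_sub [DecidableEq ι] {P : Matrix ι ι ℂ} (hP : P.PosSemidef) :
    (P.trace.re • (1 : Matrix ι ι ℂ) - P).PosSemidef := by
  rw [Matrix.posSemidef_iff_isHermitian_and_spectrum_nonneg]
  refine ⟨?_, ?_⟩
  · exact ((Matrix.PosSemidef.one (R := ℂ)).isHermitian.smul (IsSelfAdjoint.all _)).sub hP.1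
  · have h : P.trace.re • (1 : Matrix ι ι ℂ) - P =
        algebraMap ℂ _ (P.trace.re : ℂ) - P := by
      rw [Algebra.algebraMap_eq_smul_one, Complex.coe_smul]
    rw [h, ← spectrum.singleton_sub_eq, hP.1.spectrum_eq_image_range]
    rintro _ ⟨_, rfl, _, ⟨_, ⟨i, rfl⟩, rfl⟩, rfl⟩
    have ht : P.trace.re = ∑ j, hP.1.eigenvalues j := by
      simp [hP.1.trace_eq_sum_eigenvalues]
    simp only [ht, sub_nonneg, Set.mem_ofPred_eq]
    refine Complex.real_le_real.2 ?_
    exact Finset.single_le_sum (fun j _ => hP.eigenvalues_nonneg j) (Finset.mem_univ i)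

lemma PosSemidef.trace_eq_re {P : Matrix ι ι ℂ} (hP : P.PosSemidef) :
    P.trace = (P.trace.re : ℂ) := by
  have h := hP.trace_nonneg
  rw [Complex.le_def] at h
  apply Complex.ext <;> simp [← h.2]

lemma PosSemidef.re_trace_nonneg {P : Matrix ι ι ℂ} (hP : P.PosSemidef) : 0 ≤ P.trace.re := 
  (Complex.le_def.1 hP.trace_nonneg).1

end Psd

/-! ### Compactness and convexity of the sets of separable operators -/

section Compact

/-- By Carathéodory, the convex hull is a finite union of images of compact sets of weights and
points. -/
lemma isCompact_convexHull {E : Type*} [NormedAddCommGroup E] [NormedSpace ℝ E]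
    [FiniteDimensional ℝ E] {s : Set E} (hs : IsCompact s) :
    IsCompact (convexHull ℝ s) := by
  have h : convexHull ℝ s = ⋃ k ∈ Finset.range (Module.finrank ℝ E + 2),
      (fun p : (Fin k → ℝ) × (Fin k → E) => ∑ i, p.1 i • p.2 i) ''
        (stdSimplex ℝ (Fin k) ×ˢ Set.univ.pi fun _ => s) := by
    apply Set.Subset.antisymm
    · intro x hx
      obtain ⟨ι, _, z, w, hz, hi, hw, hw1, rfl⟩ := eq_pos_convex_span_of_mem_convexHull hx
      have hc := hi.card_le_finrank_succ
      have hc2 := Submodule.finrank_le (vectorSpan ℝ (Set.range z))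
      simp only [Set.mem_iUnion]
      refine ⟨Fintype.card ι, by simp; omega, ?_⟩
      let e := (Fintype.equivFin ι).symm
      refine ⟨(w ∘ e, z ∘ e), ⟨⟨fun i => (hw _).le, ?_⟩, fun i _ => hz ⟨_, rfl⟩⟩, ?_⟩
      · simpa using (e.sum_comp w).trans hw1
      · exact e.sum_comp (fun i => w i • z i)
    · refine Set.iUnion₂_subset fun k _ => ?_
      rintro _ ⟨⟨w, z⟩, ⟨hw, hz⟩, rfl⟩
      exact (convex_convexHull ℝ s).sum_mem (fun i _ => hw.1 i) hw.2
        fun i _ => subset_convexHull ℝ s (hz i trivial)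
  rw [h]
  refine Finset.isCompact_biUnion _ fun k _ => ?_
  refine ((isCompact_stdSimplex ℝ (Fin k)).prod (isCompact_univ_pi fun _ => hs)).image ?_
  fun_prop

variable {ι κ : Type*} [Fintype ι] [Fintype κ]

lemma isClosed_posSemidef : IsClosed {X : Matrix ι ι ℂ | X.PosSemidef} := by
  simp only [Matrix.posSemidef_iff_dotProduct_mulVec, Matrix.IsHermitian, Set.ofPred_and,
    Set.ofPred_forall]
  refine IsClosed.inter (isClosed_eq (by fun_prop) (by fun_prop)) (isClosed_iInter fun x => ?_)
  exact isClosed_le (by fun_prop) (by fun_prop)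

lemma norm_apply_le_trace {P : Matrix ι ι ℂ} (hP : P.PosSemidef) (i j : ι) :
    ‖P i j‖ ≤ P.trace.re := by
  have hd (k : ι) : (P k k).re ≤ P.trace.re := by
    rw [Matrix.trace, Complex.re_sum]
    exact Finset.single_le_sum (f := fun k => (P k k).re)
      (fun k _ => (Complex.le_def.1 hP.diag_nonneg).1) (Finset.mem_univ k)
  suffices h : ‖P i j‖ ≤ ((P i i).re + (P j j).re) / 2 by linarith [hd i, hd j]
  classical
  obtain ⟨B, rfl⟩ := CStarAlgebra.nonneg_iff_eq_star_mul_self.mp hP.nonneg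
  have hdiag (k : ι) : ((star B * B) k k).re = ∑ l, ‖B l k‖ ^ 2 := by
    rw [Matrix.mul_apply, Complex.re_sum]
    refine Finset.sum_congr rfl fun l _ => ?_
    rw [Matrix.star_apply, ← Complex.normSq_eq_norm_sq, Complex.normSq_apply]
    simp
  rw [hdiag, hdiag, ← Finset.sum_add_distrib, Finset.sum_div, Matrix.mul_apply]
  refine (norm_sum_le _ _).trans (Finset.sum_le_sum fun l _ => ?_)
  rw [Matrix.star_apply, norm_mul, norm_star]
  nlinarith [sq_nonneg (‖B l i‖ - ‖B l j‖)]

/-- Entries of a state are bounded by its trace. -/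
lemma isCompact_state : IsCompact {X : Matrix ι ι ℂ | IsState X} := by
  have hc : IsCompact
      (Set.univ.pi fun _ : ι => Set.univ.pi fun _ : ι => Metric.closedBall (0 : ℂ) 1) :=
    isCompact_univ_pi fun _ => isCompact_univ_pi fun _ => isCompact_closedBall _ _
  refine IsCompact.of_isClosed_subset hc ?_ ?_
  · exact isClosed_posSemidef.inter (isClosed_eq (by fun_prop) (by fun_prop))
  · rintro X ⟨hX, h1⟩ i - j -
    simpa [h1] using norm_apply_le_trace hX i j

/-- `Sep` is the convex hull of the continuous image of a product of compact state spaces. -/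
lemma isCompact_sep : IsCompact (Sep ι κ) := by
  let _ : NormedAddCommGroup (Matrix (ι × κ) (ι × κ) ℂ) := Matrix.normedAddCommGroup
  let _ : NormedSpace ℝ (Matrix (ι × κ) (ι × κ) ℂ) := Matrix.normedSpace
  have : {X : Matrix (ι × κ) (ι × κ) ℂ | ∃ (α : Matrix ι ι ℂ) (β : Matrix κ κ ℂ),
    IsState α ∧ IsState β ∧ X = α ⊗ₖ β} = (fun p : Matrix ι ι ℂ × Matrix κ κ ℂ => p.1 ⊗ₖ p.2) ''
      ({X | IsState X} ×ˢ {X | IsState X}) := by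
    ext X
    simp only [Set.mem_ofPred_eq, Set.mem_image, Set.mem_prod, Prod.exists]
    exact ⟨fun ⟨α, β, h1, h2, h3⟩ => ⟨α, β, ⟨h1, h2⟩, h3.symm⟩,
      fun ⟨α, β, ⟨h1, h2⟩, h3⟩ => ⟨α, β, h1, h2, h3.symm⟩⟩
  have h2 : IsCompact {X : Matrix (ι × κ) (ι × κ) ℂ | ∃ (α : Matrix ι ι ℂ) (β : Matrix κ κ ℂ),
    IsState α ∧ IsState β ∧ X = α ⊗ₖ β} := by
    rw [this]
    refine (isCompact_state.prod isCompact_state).image ?_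
    refine continuous_matrix fun x y => ?_
    exact (continuous_fst.matrix_elem x.1 y.1).mul (continuous_snd.matrix_elem x.2 y.2)
  exact isCompact_convexHull h2

lemma convex_sep : Convex ℝ (Sep ι κ) := convex_convexHull _ _

/-- Uses `s • Sep + t • Sep = (s + t) • Sep`, valid for the convex set `Sep`. -/
lemma convex_subSep : Convex ℝ (SubSep ι κ) := by
  rintro _ ⟨t, ht, ht1, σ, hσ, rfl⟩ _ ⟨u, hu, hu1, τ, hτ, rfl⟩ x y hx hy hxy
  have h : x • t • σ + y • u • τ ∈ (x * t) • Sep ι κ + (y * u) • Sep ι κ :=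
    Set.add_mem_add ⟨σ, hσ, by simp [smul_smul]⟩ ⟨τ, hτ, by simp [smul_smul]⟩
  rw [← convex_sep.add_smul (by positivity) (by positivity)] at h
  obtain ⟨ω, hω, h⟩ := h
  exact ⟨x * t + y * u, by positivity, by nlinarith, ω, hω, h.symm⟩

lemma isCompact_subSep : IsCompact (SubSep ι κ) := by
  have : SubSep ι κ = (fun p : ℝ × Matrix (ι × κ) (ι × κ) ℂ => p.1 • p.2) ''
      (Set.Icc 0 1 ×ˢ Sep ι κ) := by
    ext X
    simp only [SubSep, Set.mem_ofPred_eq, Set.mem_image, Set.mem_prod, Prod.exists, Set.mem_Icc]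
    exact ⟨fun ⟨t, h0, h1, σ, hσ, h⟩ => ⟨t, σ, ⟨⟨h0, h1⟩, hσ⟩, h.symm⟩,
      fun ⟨t, σ, ⟨⟨h0, h1⟩, hσ⟩, h⟩ => ⟨t, h0, h1, σ, hσ, h.symm⟩⟩
  rw [this]
  exact (isCompact_Icc.prod isCompact_sep).image (by fun_prop)

end Compact

/-! ### Separable states -/

section SepBasic
variable {ι κ : Type*} [Fintype ι] [Fintype κ]

lemma IsState.re_trace {X : Matrix ι ι ℂ} (h : IsState X) : X.trace.re = 1 := by simp [h.2]

lemma convex_isState : Convex ℝ {X : Matrix ι ι ℂ | IsState X} := by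
  rintro X ⟨hX, hX1⟩ Y ⟨hY, hY1⟩ x y hx hy hxy
  refine ⟨(hX.smul hx).add (hY.smul hy), ?_⟩
  rw [Matrix.trace_add, Matrix.trace_smul, Matrix.trace_smul, hX1, hY1, ← add_smul, hxy, one_smul]

lemma IsState.kronecker {α : Matrix ι ι ℂ} {β : Matrix κ κ ℂ} (hα : IsState α) (hβ : IsState β) :
    IsState (α ⊗ₖ β) :=
  ⟨hα.1.kronecker hβ.1, by rw [Matrix.trace_kronecker, hα.2, hβ.2, one_mul]⟩

lemma kronecker_mem_sep {α : Matrix ι ι ℂ} {β : Matrix κ κ ℂ} (hα : IsState α)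
    (hβ : IsState β) : α ⊗ₖ β ∈ Sep ι κ :=
  subset_convexHull ℝ _ ⟨α, β, hα, hβ, rfl⟩

lemma isState_of_mem_sep {σ : Matrix (ι × κ) (ι × κ) ℂ} (h : σ ∈ Sep ι κ) : IsState σ := by
  refine convexHull_min ?_ convex_isState h
  rintro _ ⟨α, β, hα, hβ, rfl⟩
  exact hα.kronecker hβ

lemma isState_single [DecidableEq ι] (i : ι) : IsState (Matrix.single i i (1 : ℂ)) := by
  refine ⟨?_, by simp⟩
  simpa [Matrix.single_eq_single_vecMulVec_single] using
    Matrix.posSemidef_vecMulVec_self_star (Pi.single i (1 : ℂ))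

/-- A linear map that sends product states to separable states sends `Sep` into `Sep`. -/
lemma map_mem_sep {ι' κ' : Type*} [Fintype ι'] [Fintype κ']
    (T : Matrix (ι × κ) (ι × κ) ℂ →ₗ[ℝ] Matrix (ι' × κ') (ι' × κ') ℂ)
    (hT : ∀ α β, IsState α → IsState β → T (α ⊗ₖ β) ∈ Sep ι' κ')
    {σ : Matrix (ι × κ) (ι × κ) ℂ} (hσ : σ ∈ Sep ι κ) : T σ ∈ Sep ι' κ' := by
  refine convexHull_min (t := T ⁻¹' Sep ι' κ') ?_ (convex_sep.linear_preimage T) hσ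
  rintro _ ⟨α, β, hα, hβ, rfl⟩
  exact hT α β hα hβ

end SepBasic

/-! ### The order relation behind `Ω` -/

section Omega
variable {ι : Type*} [Fintype ι]

/-- `X ≤ η Y ≤ γ X` for some `η > 0`, the order relation behind `Ω(X, Y) ≤ γ`. -/
def Sandwich {ι : Type*} (X Y : Matrix ι ι ℂ) (γ : ℝ) : Prop :=
  ∃ η : ℝ, 0 < η ∧ (η • Y - X).PosSemidef ∧ (γ • X - η • Y).PosSemidef

lemma re_trace_le_of_posSemidef_sub {X Y : Matrix ι ι ℂ} {c d : ℝ}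
    (h : (c • Y - d • X).PosSemidef) : d * X.trace.re ≤ c * Y.trace.re := by
  have := PosSemidef.re_trace_nonneg h
  simpa [Matrix.trace_sub, Matrix.trace_smul] using this

lemma Sandwich.one_le {X Y : Matrix ι ι ℂ} (hX : IsState X) {γ : ℝ} (h : Sandwich X Y γ) :
    1 ≤ γ := by
  obtain ⟨η, hη, h1, h2⟩ := h
  have h3 := h1.add h2
  rw [sub_add_sub_cancel', ← one_smul ℝ X, smul_smul] at h3
  have := re_trace_le_of_posSemidef_sub h3
  simpa [hX.2] using this

lemma Sandwich.map {ι κ : Type*} {X Y : Matrix ι ι ℂ} {γ : ℝ} (h : Sandwich X Y γ)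
    (T : Matrix ι ι ℂ →ₗ[ℝ] Matrix κ κ ℂ) (hT : ∀ P, P.PosSemidef → (T P).PosSemidef) :
    Sandwich (T X) (T Y) γ := by
  obtain ⟨η, hη, h1, h2⟩ := h
  refine ⟨η, hη, ?_, ?_⟩
  · simpa using hT _ h1
  · simpa using hT _ h2

lemma Sandwich.kronecker {κ : Type*} [Fintype κ] {X Y : Matrix ι ι ℂ} {X' Y' : Matrix κ κ ℂ}
    {γ γ' : ℝ} (hX : IsState X) (hX' : IsState X') (hY : Y.PosSemidef) (hY' : Y'.PosSemidef)
    (h : Sandwich X Y γ) (h' : Sandwich X' Y' γ') :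
    Sandwich (X ⊗ₖ X') (Y ⊗ₖ Y') (γ * γ') := by
  have hγ := h.one_le hX
  have hγ' := h'.one_le hX'
  obtain ⟨η, hη, h1, h2⟩ := h
  obtain ⟨η', hη', h1', h2'⟩ := h'
  refine ⟨η * η', by positivity, ?_, ?_⟩
  · have e : (η * η') • (Y ⊗ₖ Y') - X ⊗ₖ X' =
        (η • Y - X) ⊗ₖ (η' • Y') + X ⊗ₖ (η' • Y' - X') := by
      ext i j
      simp
      ring
    rw [e]
    exact (h1.kronecker (hY'.smul hη'.le)).add (hX.1.kronecker h1')
  · have e : (γ * γ') • (X ⊗ₖ X') - (η * η') • (Y ⊗ₖ Y') =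
        (γ • X - η • Y) ⊗ₖ (γ' • X') + (η • Y) ⊗ₖ (γ' • X' - η' • Y') := by
      ext i j
      simp
      ring
    rw [e]
    exact (h2.kronecker (hX'.1.smul (zero_le_one.trans hγ'))).add
      ((hY.smul hη.le).kronecker h2')

variable [DecidableEq ι]

/-- `0 ≤ X ≤ c Y` implies `ker Y ≤ ker X`. -/
lemma ker_le_ker_of_posSemidef_sub {X Y : Matrix ι ι ℂ} (hX : X.PosSemidef) {c : ℝ}
    (h : (c • Y - X).PosSemidef) :
    LinearMap.ker (Matrix.toEuclideanLin Y) ≤ LinearMap.ker (Matrix.toEuclideanLin X) := by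
  intro v hv
  have hv' : Y *ᵥ v.ofLp = 0 := by
    simpa [Matrix.toLpLin_apply] using congrArg WithLp.ofLp (LinearMap.mem_ker.1 hv)
  have h0 := h.dotProduct_mulVec_nonneg v.ofLp
  rw [Matrix.sub_mulVec, Matrix.smul_mulVec, hv', smul_zero, zero_sub, dotProduct_neg] at h0
  have h1 : star v.ofLp ⬝ᵥ X *ᵥ v.ofLp = 0 :=
    le_antisymm (by simpa using h0) (hX.dotProduct_mulVec_nonneg _)
  rw [hX.dotProduct_mulVec_zero_iff] at h1
  rw [LinearMap.mem_ker, Matrix.toLpLin_apply, h1]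
  rfl

/-- The support condition in the definition of `Ω` is automatic, because `η > 0`. -/
lemma Sandwich.omega_le {X Y : Matrix ι ι ℂ} (hX : X.PosSemidef) (hY : Y.PosSemidef) {γ : ℝ≥0}
    (h : Sandwich X Y γ) : Omega X Y ≤ γ := by
  obtain ⟨η, hη, h1, h2⟩ := h
  have hs : supp X = supp Y := by
    refine congrArg Submodule.orthogonal (le_antisymm ?_ (ker_le_ker_of_posSemidef_sub hX h1))
    refine ker_le_ker_of_posSemidef_sub (c := η⁻¹ * γ) hY ?_
    have := h2.smul (inv_pos.2 hη).le
    rwa [smul_sub, smul_smul, smul_smul, inv_mul_cancel₀ hη.ne', one_smul] at this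
  rw [Omega, if_pos hs]
  exact iInf_le_of_le γ (iInf_le_of_le ⟨η, hη.le⟩ (iInf_le_of_le h1 (iInf_le_of_le h2 le_rfl)))

lemma exists_of_omega_lt {X Y : Matrix ι ι ℂ} {c : ℝ≥0∞} (h : Omega X Y < c) :
    ∃ γ η : ℝ≥0, (γ : ℝ≥0∞) < c ∧ ((η : ℝ) • Y - X).PosSemidef ∧
      ((γ : ℝ) • X - (η : ℝ) • Y).PosSemidef := by
  rw [Omega] at h
  split_ifs at h
  · simp only [iInf_lt_iff] at h
    obtain ⟨γ, η, h1, h2, h3⟩ := h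
    exact ⟨γ, η, h3, h1, h2⟩
  · exact absurd h not_top_lt

/-- For a state `X`, an admissible `η` cannot vanish, as `X ≤ η Y`. -/
lemma sandwich_of_omega_lt {X Y : Matrix ι ι ℂ} (hX : IsState X) {c : ℝ≥0∞}
    (h : Omega X Y < c) : ∃ γ : ℝ≥0, (γ : ℝ≥0∞) < c ∧ Sandwich X Y γ := by
  obtain ⟨γ, η, h1, h2, h3⟩ := exists_of_omega_lt h
  refine ⟨γ, h1, η, ?_, h2, h3⟩
  rcases eq_or_ne η 0 with rfl | hη
  · have := PosSemidef.re_trace_nonneg h2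
    simp [hX.2] at this
    linarith
  · exact_mod_cast pos_iff_ne_zero.2 hη

end Omega

/-! ### The quantity `Ω̂_Sep` -/

section OmegaHat
variable {ι κ : Type*} [Fintype ι] [Fintype κ] [DecidableEq ι] [DecidableEq κ]

lemma Sandwich.omegaHat_le {ρ σ : Matrix (ι × κ) (ι × κ) ℂ} (hρ : ρ.PosSemidef)
    (hσ : σ ∈ Sep ι κ) {γ : ℝ≥0} (h : Sandwich σ ρ γ) : OmegaHat (Sep ι κ) ρ ≤ γ :=
  iInf₂_le_of_le σ hσ (h.omega_le (isState_of_mem_sep hσ).1 hρ)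

lemma sandwich_of_omegaHat_lt {ρ : Matrix (ι × κ) (ι × κ) ℂ} {c : ℝ≥0∞}
    (h : OmegaHat (Sep ι κ) ρ < c) :
    ∃ σ ∈ Sep ι κ, ∃ γ : ℝ≥0, (γ : ℝ≥0∞) < c ∧ Sandwich σ ρ γ := by
  simp only [OmegaHat, iInf_lt_iff] at h
  obtain ⟨σ, hσ, h⟩ := h
  exact ⟨σ, hσ, sandwich_of_omega_lt (isState_of_mem_sep hσ) h⟩

lemma one_le_omegaHat (ρ : Matrix (ι × κ) (ι × κ) ℂ) : 1 ≤ OmegaHat (Sep ι κ) ρ := by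
  by_contra! h
  obtain ⟨σ, hσ, γ, hγ, h⟩ := sandwich_of_omegaHat_lt h
  have := h.one_le (isState_of_mem_sep hσ)
  exact absurd hγ (not_lt.2 (by exact_mod_cast this))

/-- Data processing: positive maps that preserve separability do not increase `Ω̂`. -/
lemma omegaHat_map_le {ι' κ' : Type*} [Fintype ι'] [Fintype κ'] [DecidableEq ι'] [DecidableEq κ']
    (T : Matrix (ι × κ) (ι × κ) ℂ →ₗ[ℝ] Matrix (ι' × κ') (ι' × κ') ℂ)
    (hT : ∀ P, P.PosSemidef → (T P).PosSemidef) (hS : ∀ σ ∈ Sep ι κ, T σ ∈ Sep ι' κ')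
    {ρ : Matrix (ι × κ) (ι × κ) ℂ} (hρ : ρ.PosSemidef) :
    OmegaHat (Sep ι' κ') (T ρ) ≤ OmegaHat (Sep ι κ) ρ := by
  refine le_of_forall_gt fun c hc => ?_
  obtain ⟨σ, hσ, γ, hγ, h⟩ := sandwich_of_omegaHat_lt hc
  exact ((h.map T hT).omegaHat_le (hT _ hρ) (hS σ hσ)).trans_lt hγ

end OmegaHat

/-! ### Tensor powers -/

section TensorPow
variable {a b : Type*}

/-- The splitting of the bipartite index of `n + k` copies into those of `n` and `k` copies. -/
def splitIdx {a b : Type*} (n k : ℕ) : (Fin (n + k) → a) × (Fin (n + k) → b) ≃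
    ((Fin n → a) × (Fin n → b)) × ((Fin k → a) × (Fin k → b)) :=
  ((Fin.appendEquiv n k).symm.prodCongr (Fin.appendEquiv n k).symm).trans
    (Equiv.prodProdProdComm _ _ _ _)

lemma tensorPow_add (ρ : Matrix (a × b) (a × b) ℂ) (n k : ℕ) :
    tensorPow ρ (n + k) =
      (tensorPow ρ n ⊗ₖ tensorPow ρ k).submatrix (splitIdx n k) (splitIdx n k) := by
  ext x y
  simp [tensorPow, splitIdx, Fin.prod_univ_add, Fin.appendEquiv]

lemma kronecker_submatrix_splitIdx {n k : ℕ} (α : Matrix (Fin n → a) (Fin n → a) ℂ)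
    (β : Matrix (Fin n → b) (Fin n → b) ℂ) (α' : Matrix (Fin k → a) (Fin k → a) ℂ)
    (β' : Matrix (Fin k → b) (Fin k → b) ℂ) :
    ((α ⊗ₖ β) ⊗ₖ (α' ⊗ₖ β')).submatrix (splitIdx n k) (splitIdx n k) =
      ((α ⊗ₖ α').submatrix (Fin.appendEquiv n k).symm (Fin.appendEquiv n k).symm) ⊗ₖ
        ((β ⊗ₖ β').submatrix (Fin.appendEquiv n k).symm (Fin.appendEquiv n k).symm) := by
  ext x y
  simp [splitIdx, mul_mul_mul_comm]

variable [Fintype a] [Fintype b]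

lemma IsState.submatrix {ι κ : Type*} [Fintype ι] [Fintype κ] {X : Matrix ι ι ℂ} (hX : IsState X)
    (e : κ ≃ ι) : IsState (X.submatrix e e) := by
  refine ⟨hX.1.submatrix _, ?_⟩
  rw [← hX.2]
  exact e.sum_comp fun i => X i i

lemma isState_tensorPow {ρ : Matrix (a × b) (a × b) ℂ} (hρ : IsState ρ) (n : ℕ) :
    IsState (tensorPow ρ n) := by
  induction n with
  | zero =>
    have : tensorPow ρ 0 = 1 := by
      ext x y
      rw [Subsingleton.elim x y]
      simp [tensorPow]
    rw [this]
    exact ⟨.one, by simp⟩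
  | succ n ih =>
    rw [tensorPow_add]
    refine (ih.kronecker ?_).submatrix _
    have : tensorPow ρ 1 = ρ.submatrix
        ((Equiv.funUnique (Fin 1) a).prodCongr (Equiv.funUnique (Fin 1) b))
        ((Equiv.funUnique (Fin 1) a).prodCongr (Equiv.funUnique (Fin 1) b)) := by
      ext x y
      simp only [tensorPow, Matrix.of_apply, Fin.prod_univ_one]
      rfl
    rw [this]
    exact hρ.submatrix _

/-- Separable states on `n` and on `k` copies combine to a separable state on `n + k` copies. -/
lemma submatrix_splitIdx_mem_sep {n k : ℕ}
    {σ : Matrix ((Fin n → a) × (Fin n → b)) ((Fin n → a) × (Fin n → b)) ℂ}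
    {τ : Matrix ((Fin k → a) × (Fin k → b)) ((Fin k → a) × (Fin k → b)) ℂ}
    (hσ : σ ∈ Sep _ _) (hτ : τ ∈ Sep _ _) :
    (σ ⊗ₖ τ).submatrix (splitIdx n k) (splitIdx n k) ∈ Sep (Fin (n + k) → a) (Fin (n + k) → b) := by
  let B : Matrix ((Fin n → a) × (Fin n → b)) ((Fin n → a) × (Fin n → b)) ℂ →ₗ[ℝ]
      Matrix ((Fin k → a) × (Fin k → b)) ((Fin k → a) × (Fin k → b)) ℂ →ₗ[ℝ]
      Matrix ((Fin (n + k) → a) × (Fin (n + k) → b)) ((Fin (n + k) → a) × (Fin (n + k) → b)) ℂ :=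
    LinearMap.mk₂ ℝ (fun σ τ => (σ ⊗ₖ τ).submatrix (splitIdx n k) (splitIdx n k))
      (fun _ _ _ => by ext; simp [add_mul]) (fun _ _ _ => by ext; simp [mul_assoc])
      (fun _ _ _ => by ext; simp [mul_add]) (fun _ _ _ => by ext; simp [mul_left_comm])
  refine map_mem_sep (B.flip τ) (fun α β hα hβ => ?_) hσ
  refine map_mem_sep (B (α ⊗ₖ β)) (fun α' β' hα' hβ' => ?_) hτ
  have := kronecker_submatrix_splitIdx α β α' β'
  simp only [B, LinearMap.mk₂_apply]
  rw [this]
  exact kronecker_mem_sep ((hα.kronecker hα').submatrix _) ((hβ.kronecker hβ').submatrix _)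

/-- The trace over the last factor, after the index has been split by `e`. -/
def partialTrace {ι κ τ : Type*} [Fintype κ] (e : τ ≃ ι × κ) :
    Matrix τ τ ℂ →ₗ[ℝ] Matrix ι ι ℂ :=
  ∑ z : κ,
    { toFun := fun X => X.submatrix (fun x => e.symm (x, z)) fun x => e.symm (x, z)
      map_add' := fun _ _ => rfl
      map_smul' := fun _ _ => rfl }

lemma partialTrace_apply {ι κ τ : Type*} [Fintype κ] (e : τ ≃ ι × κ) (X : Matrix τ τ ℂ) (x y : ι) :
    partialTrace e X x y = ∑ z, X (e.symm (x, z)) (e.symm (y, z)) := by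
  rw [partialTrace, LinearMap.sum_apply, Matrix.sum_apply]
  rfl

lemma partialTrace_posSemidef {ι κ τ : Type*} [Fintype κ] (e : τ ≃ ι × κ) {X : Matrix τ τ ℂ}
    (hX : X.PosSemidef) : (partialTrace e X).PosSemidef := by
  rw [partialTrace, LinearMap.sum_apply]
  exact Matrix.posSemidef_sum _ fun z _ => hX.submatrix _

lemma IsState.partialTrace {ι κ τ : Type*} [Fintype ι] [Fintype κ] [Fintype τ] (e : τ ≃ ι × κ)
    {X : Matrix τ τ ℂ} (hX : IsState X) : IsState (partialTrace e X) := by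
  refine ⟨partialTrace_posSemidef e hX.1, ?_⟩
  rw [← (hX.submatrix e.symm).2]
  simp [Matrix.trace, partialTrace_apply, Fintype.sum_prod_type]

lemma partialTrace_tensorPow {ρ : Matrix (a × b) (a × b) ℂ} (hρ : IsState ρ) (n k : ℕ) :
    partialTrace (splitIdx n k) (tensorPow ρ (n + k)) = tensorPow ρ n := by
  ext x y
  rw [partialTrace_apply, tensorPow_add]
  simp only [Matrix.submatrix_apply, Equiv.apply_symm_apply, Matrix.kronecker_apply,
    ← Finset.mul_sum]
  have := (isState_tensorPow hρ k).2
  rw [Matrix.trace] at this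
  simp only [Matrix.diag_apply] at this
  rw [this, mul_one]

lemma partialTrace_kronecker {n k : ℕ} (α : Matrix (Fin (n + k) → a) (Fin (n + k) → a) ℂ)
    (β : Matrix (Fin (n + k) → b) (Fin (n + k) → b) ℂ) :
    partialTrace (splitIdx n k) (α ⊗ₖ β) =
      partialTrace (Fin.appendEquiv n k).symm α ⊗ₖ partialTrace (Fin.appendEquiv n k).symm β := by
  ext x y
  simp [partialTrace_apply, splitIdx, Fintype.sum_prod_type, Finset.sum_mul_sum]

variable [DecidableEq a] [DecidableEq b]

lemma omegaHat_tensorPow_add_le {ρ : Matrix (a × b) (a × b) ℂ} (hρ : IsState ρ) (n k : ℕ) :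
    OmegaHat (Sep _ _) (tensorPow ρ (n + k)) ≤
      OmegaHat (Sep _ _) (tensorPow ρ n) * OmegaHat (Sep _ _) (tensorPow ρ k) := by
  have h0 (j : ℕ) : OmegaHat (Sep _ _) (tensorPow ρ j) ≠ 0 :=
    (zero_lt_one.trans_le (one_le_omegaHat _)).ne'
  refine ENNReal.le_mul_of_forall_lt (.inl (h0 _)) (.inr (h0 _)) fun c hc d hd => ?_
  obtain ⟨σ, hσ, γ, hγ, h⟩ := sandwich_of_omegaHat_lt hc
  obtain ⟨τ, hτ, δ, hδ, h'⟩ := sandwich_of_omegaHat_lt hd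
  refine le_trans ?_ (mul_le_mul' hγ.le hδ.le)
  rw [tensorPow_add, ← ENNReal.coe_mul]
  refine Sandwich.omegaHat_le
    (((isState_tensorPow hρ n).kronecker (isState_tensorPow hρ k)).submatrix _).1
    (submatrix_splitIdx_mem_sep hσ hτ) ?_
  have hs := h.kronecker (isState_of_mem_sep hσ) (isState_of_mem_sep hτ)
    (isState_tensorPow hρ n).1 (isState_tensorPow hρ k).1 h'
  rw [NNReal.coe_mul]
  exact hs.map
    { toFun := fun X => X.submatrix (splitIdx n k) (splitIdx n k)
      map_add' := fun _ _ => rfl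
      map_smul' := fun _ _ => rfl } fun P hP => hP.submatrix _

/-- Discarding copies by a local partial trace turns the bound for `n + k` copies into one for
`n` copies. -/
lemma omegaHat_tensorPow_le_add {ρ : Matrix (a × b) (a × b) ℂ} (hρ : IsState ρ) (n k : ℕ) :
    OmegaHat (Sep _ _) (tensorPow ρ n) ≤ OmegaHat (Sep _ _) (tensorPow ρ (n + k)) := by
  have := omegaHat_map_le (ι' := Fin n → a) (κ' := Fin n → b) (partialTrace (splitIdx n k))
    (fun P hP => partialTrace_posSemidef _ hP)
    (fun σ hσ => map_mem_sep _ (fun α β hα hβ => by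
      rw [partialTrace_kronecker]
      exact kronecker_mem_sep (hα.partialTrace _) (hβ.partialTrace _)) hσ)
    (isState_tensorPow hρ (n + k)).1
  rwa [partialTrace_tensorPow hρ] at this

end TensorPow

/-! ### Existence of the regularized limit -/

section Limit

lemma log2_mono {x y : ℝ≥0∞} (h : x ≤ y) : log2 x ≤ log2 y :=
  EReal.div_le_div_right_of_nonneg (by exact_mod_cast (Real.log_pos one_lt_two).le)
    (ENNReal.log_le_log h)

lemma log2_ofReal {x : ℝ} (hx : 0 < x) : log2 (ENNReal.ofReal x) = (Real.logb 2 x : ℝ) := by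
  rw [log2, ENNReal.log_ofReal_of_pos hx, ← EReal.coe_div, Real.logb]

lemma log2_top : log2 ⊤ = ⊤ := by
  rw [log2, ENNReal.log_top]
  exact EReal.top_div_of_pos_ne_top (by exact_mod_cast Real.log_pos one_lt_two) (EReal.coe_ne_top _)

variable {a b : Type*} [Fintype a] [DecidableEq a] [Fintype b] [DecidableEq b]

/-- By monotonicity and submultiplicativity in `n`, the numbers `Ω̂_Sep(ρ^{⊗n})`, `n ≥ 1`, are all
finite or all infinite; in the finite case Fekete's lemma applies to their logarithms. -/
lemma exists_tendsto_regSeq {ρ : Matrix (a × b) (a × b) ℂ} (hρ : IsState ρ) :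
    ∃ R, Tendsto (regSeq ρ) atTop (𝓝 R) := by
  set Ω : ℕ → ℝ≥0∞ := fun n => OmegaHat (Sep (Fin n → a) (Fin n → b)) (tensorPow ρ n) with hΩ
  have hadd (n k : ℕ) : Ω (n + k) ≤ Ω n * Ω k := omegaHat_tensorPow_add_le hρ n k
  have hmono (n k : ℕ) : Ω n ≤ Ω (n + k) := omegaHat_tensorPow_le_add hρ n k
  have hone (n : ℕ) : 1 ≤ Ω n := one_le_omegaHat _
  by_cases h1 : Ω 1 = ⊤
  -- the index `0` is left out: `ρ^{⊗0}` is the trivial state and `1 / 0 = 0`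
  · refine ⟨⊤, tendsto_const_nhds.congr' ?_⟩
    filter_upwards [eventually_ge_atTop 1] with n hn
    have hn' : Ω n = ⊤ := by
      obtain ⟨k, rfl⟩ := Nat.exists_eq_add_of_le hn
      exact top_unique (h1 ▸ hmono 1 k)
    have : (0 : ℝ) < 1 / n := by positivity
    change ⊤ = ((1 / n : ℝ) : EReal) * log2 (Ω n)
    rw [hn', log2_top, EReal.coe_mul_top_of_pos this]
  · have hfin (n : ℕ) : Ω n ≠ ⊤ := by
      induction n with
      | zero => exact ne_top_of_le_ne_top h1 (by simpa using hmono 0 1)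
      | succ n ih => exact ne_top_of_le_ne_top (ENNReal.mul_ne_top ih h1) (hadd n 1)
    have hone' (n : ℕ) : 1 ≤ (Ω n).toReal := by
      simpa using ENNReal.toReal_mono (hfin n) (hone n)
    have hpos (n : ℕ) : 0 < (Ω n).toReal := zero_lt_one.trans_le (hone' n)
    have hsub : Subadditive fun n => Real.logb 2 (Ω n).toReal := by
      intro n k
      rw [← Real.logb_mul (hpos n).ne' (hpos k).ne', ← ENNReal.toReal_mul]
      exact Real.logb_le_logb_of_le one_lt_two (hpos _)
        (ENNReal.toReal_mono (ENNReal.mul_ne_top (hfin n) (hfin k)) (hadd n k))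
    have hbdd : BddBelow (Set.range fun n : ℕ => Real.logb 2 (Ω n).toReal / n) := by
      refine ⟨0, ?_⟩
      rintro _ ⟨n, rfl⟩
      exact div_nonneg (Real.logb_nonneg one_lt_two (hone' n)) n.cast_nonneg
    refine ⟨(hsub.lim : ℝ), ?_⟩
    refine (continuous_coe_real_ereal.continuousAt.tendsto.comp (hsub.tendsto_lim hbdd)).congr
      fun n => ?_
    change _ = ((1 / n : ℝ) : EReal) * log2 (Ω n)
    rw [← ENNReal.ofReal_toReal (hfin n), log2_ofReal (hpos n), ← EReal.coe_mul,
      Function.comp_apply]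
    congr 1
    ring

end Limit

/-! ### Fidelity with a pure state -/

section Fidelity
variable {ι : Type*} [Fintype ι] [DecidableEq ι]

lemma msqrt_isHermitian (X : Matrix ι ι ℂ) : (msqrt X).IsHermitian :=
  cfc_predicate (p := IsSelfAdjoint) Real.sqrt X

lemma msqrt_mul_msqrt {X : Matrix ι ι ℂ} (hX : X.PosSemidef) : msqrt X * msqrt X = X := by
  have hsa : IsSelfAdjoint X := hX.1
  rw [msqrt, ← cfc_mul Real.sqrt Real.sqrt X]
  conv_rhs => rw [← cfc_id ℝ X hsa]
  refine cfc_congr fun x hx => ?_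
  exact Real.mul_self_sqrt (spectrum_nonneg_of_nonneg hX.nonneg hx)

/-- `√(X²) = X` for positive semidefinite `X`. -/
lemma msqrt_mul_self {X : Matrix ι ι ℂ} (hX : X.PosSemidef) : msqrt (X * X) = X := by
  have hsa : IsSelfAdjoint X := hX.1
  have h : X * X = cfc (fun x : ℝ => x * x) X := by
    rw [cfc_mul (fun x : ℝ => x) (fun x : ℝ => x) X]
    simp [cfc_id' ℝ X]
  rw [msqrt, h, ← cfc_comp Real.sqrt (fun x : ℝ => x * x) X]
  conv_rhs => rw [← cfc_id ℝ X hsa]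
  refine cfc_congr fun x hx => ?_
  exact Real.sqrt_mul_self (spectrum_nonneg_of_nonneg hX.nonneg hx)

/-- The fidelity with a pure state is the square root of the overlap. -/
lemma fidelity_vecMulVec {X : Matrix ι ι ℂ} (hX : X.PosSemidef) {v : ι → ℂ}
    (hv : star v ⬝ᵥ v = 1) :
    fidelity X (vecMulVec v (star v)) = Real.sqrt (star v ⬝ᵥ X *ᵥ v).re := by
  set P := vecMulVec v (star v) with hP
  have hPpos : P.PosSemidef := Matrix.posSemidef_vecMulVec_self_star v
  have hPP : P * P = P := by
    rw [hP, Matrix.vecMulVec_mul_vecMulVec, hv, one_smul]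
  have hsP : msqrt P = P := by
    conv_lhs => rw [← hPP]
    exact msqrt_mul_self hPpos
  have hc := hX.dotProduct_mulVec_nonneg v
  set c := star v ⬝ᵥ X *ᵥ v with hcdef
  have hc0 : 0 ≤ c.re := (Complex.le_def.1 hc).1
  have hcre : c = (c.re : ℂ) := by
    apply Complex.ext <;> simp [← (Complex.le_def.1 hc).2]
  have key : (msqrt X * P)ᴴ * (msqrt X * P) = (Real.sqrt c.re • P) * (Real.sqrt c.re • P) := by
    rw [Matrix.conjTranspose_mul, hPpos.1.eq, (msqrt_isHermitian X).eq, Matrix.mul_assoc,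
      ← Matrix.mul_assoc (msqrt X), msqrt_mul_msqrt hX, Matrix.smul_mul, Matrix.mul_smul, smul_smul,
      Real.mul_self_sqrt hc0, hPP, hP, Matrix.mul_vecMulVec, Matrix.vecMulVec_mul_vecMulVec,
      ← hcdef, hcre]
    ext i j
    simp
  rw [fidelity, hsP, traceNorm, key, msqrt_mul_self (hPpos.smul (Real.sqrt_nonneg _)),
    Matrix.trace_smul, hP, Matrix.trace_vecMulVec, dotProduct_comm, hv]
  simp

end Fidelity

/-! ### Overlap with the maximally entangled state -/

section Overlap

/-- The overlap `⟨Ψ_m, X Ψ_m⟩` (its real part) with the maximally entangled state. -/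
def overlap (m : ℕ) : Matrix (Fin m × Fin m) (Fin m × Fin m) ℂ →ₗ[ℝ] ℝ where
  toFun X := (star (maxEntVec m) ⬝ᵥ X *ᵥ maxEntVec m).re
  map_add' X Y := by simp [Matrix.add_mulVec, dotProduct_add]
  map_smul' c X := by simp [Matrix.smul_mulVec]

lemma overlap_apply (m : ℕ) (X : Matrix (Fin m × Fin m) (Fin m × Fin m) ℂ) :
    overlap m X = (star (maxEntVec m) ⬝ᵥ X *ᵥ maxEntVec m).re := rfl

lemma dotProduct_mulVec_maxEntVec (m : ℕ) (X : Matrix (Fin m × Fin m) (Fin m × Fin m) ℂ) :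
    star (maxEntVec m) ⬝ᵥ X *ᵥ maxEntVec m = (1 / m : ℝ) * ∑ i, ∑ j, X (i, i) (j, j) := by
  have h : ((1 / Real.sqrt m : ℝ) : ℂ) * ((1 / Real.sqrt m : ℝ) : ℂ) = ((1 / m : ℝ) : ℂ) := by
    rw [← Complex.ofReal_mul, div_mul_div_comm, Real.mul_self_sqrt m.cast_nonneg, one_mul]
  simp only [dotProduct, Matrix.mulVec, Fintype.sum_prod_type, maxEntVec, Pi.star_apply,
    apply_ite star, star_zero, ite_mul, mul_ite, zero_mul, mul_zero, Finset.sum_ite_eq, Finset.mem_univ, if_true,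
    Complex.star_def, Complex.conj_ofReal]
  rw [← h, Finset.mul_sum]
  refine Finset.sum_congr rfl fun i _ => ?_
  rw [Finset.mul_sum, Finset.mul_sum]
  refine Finset.sum_congr rfl fun j _ => ?_
  ring

lemma maxEntVec_unit {m : ℕ} (hm : m ≠ 0) : star (maxEntVec m) ⬝ᵥ maxEntVec m = 1 := by
  have h := dotProduct_mulVec_maxEntVec m 1
  rw [Matrix.one_mulVec] at h
  rw [h]
  simp [Matrix.one_apply, hm]

lemma overlap_nonneg {m : ℕ} {X : Matrix (Fin m × Fin m) (Fin m × Fin m) ℂ} (hX : X.PosSemidef) :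
    0 ≤ overlap m X := (Complex.le_def.1 (hX.dotProduct_mulVec_nonneg _)).1

lemma overlap_le_trace {m : ℕ} (hm : m ≠ 0) {X : Matrix (Fin m × Fin m) (Fin m × Fin m) ℂ}
    (hX : X.PosSemidef) : overlap m X ≤ X.trace.re := by
  have h := overlap_nonneg (posSemidef_trace_smul_one_sub hX)
  have h1 : overlap m 1 = 1 := by
    rw [overlap_apply, Matrix.one_mulVec, maxEntVec_unit hm, Complex.one_re]
  rw [map_sub, map_smul, h1] at h
  simpa using h

/-- Separable states have overlap at most `1 / m` with `Ψ_m`. -/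
lemma overlap_le_of_mem_sep {m : ℕ} {σ : Matrix (Fin m × Fin m) (Fin m × Fin m) ℂ}
    (hσ : σ ∈ Sep (Fin m) (Fin m)) : overlap m σ ≤ 1 / m := by
  refine convexHull_min (t := {X | overlap m X ≤ 1 / m}) ?_
    (convex_halfSpace_le (overlap m).isLinear _) hσ
  rintro _ ⟨α, β, hα, hβ, rfl⟩
  -- `∑ α i j * β i j = tr (α βᵀ) ≤ tr α * tr β`, since `α ≤ tr α`
  have h1 : (∑ i, ∑ j, (α ⊗ₖ β) (i, i) (j, j)) = (α * βᵀ).trace := by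
    simp [Matrix.trace, Matrix.mul_apply]
  obtain ⟨B, hB⟩ := CStarAlgebra.nonneg_iff_eq_star_mul_self.mp hβ.1.transpose.nonneg
  have h2 : (B * ((1 : Matrix (Fin m) (Fin m) ℂ) - α) * Bᴴ).trace = 1 - (α * βᵀ).trace := by
    rw [Matrix.trace_mul_comm, ← Matrix.mul_assoc, ← Matrix.star_eq_conjTranspose, ← hB,
      Matrix.mul_sub, Matrix.mul_one, Matrix.trace_sub, Matrix.trace_transpose, hβ.2,
      Matrix.trace_mul_comm]
  have h3 : ((1 : Matrix (Fin m) (Fin m) ℂ) - α).PosSemidef := by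
    simpa [hα.2] using posSemidef_trace_smul_one_sub hα.1
  have h4 := PosSemidef.re_trace_nonneg (h3.mul_mul_conjTranspose_same B)
  rw [h2] at h4
  change overlap m (α ⊗ₖ β) ≤ 1 / m
  rw [overlap_apply, dotProduct_mulVec_maxEntVec, h1, Complex.re_ofReal_mul]
  refine mul_le_of_le_one_right (by positivity) ?_
  simpa using h4

lemma fidelity_maxEnt {m : ℕ} (hm : m ≠ 0) {X : Matrix (Fin m × Fin m) (Fin m × Fin m) ℂ}
    (hX : X.PosSemidef) : fidelity X (maxEnt m) = Real.sqrt (overlap m X) :=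
  fidelity_vecMulVec hX (maxEntVec_unit hm)

/-- The fidelity of a normalized positive operator with `Ψ_m` in terms of its overlap and trace. -/
lemma fidelity_normalize_maxEnt {m : ℕ} (hm : m ≠ 0) {X : Matrix (Fin m × Fin m) (Fin m × Fin m) ℂ}
    (hX : X.PosSemidef) :
    fidelity (X.trace⁻¹ • X) (maxEnt m) = Real.sqrt (overlap m X / X.trace.re) := by
  have : X.trace⁻¹ • X = X.trace.re⁻¹ • X := by
    rw [PosSemidef.trace_eq_re hX, ← Complex.ofReal_inv, Complex.coe_smul, Complex.ofReal_re]
  rw [this, fidelity_maxEnt hm (hX.smul (inv_nonneg.2 (PosSemidef.re_trace_nonneg hX))), map_smul,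
    smul_eq_mul, div_eq_inv_mul]

end Overlap

/-! ### Lower bound on the error -/

section Converse

variable {a b : Type*} [Fintype a] [Fintype b]

lemma IsCP.map_posSemidef {ι κ : Type*} [Fintype ι] [Fintype κ]
    {E : Matrix ι ι ℂ →ₗ[ℂ] Matrix κ κ ℂ} (hE : IsCP E) {X : Matrix ι ι ℂ} (hX : X.PosSemidef) :
    (E X).PosSemidef :=
  (hE 1 _ (hX.submatrix Prod.snd)).submatrix fun i => (0, i)

lemma omega_lt_of_dOmega_lt {ι : Type*} [Fintype ι] [DecidableEq ι] {X Y : Matrix ι ι ℂ} {d : ℝ}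
    (h : DOmega X Y < d) : Omega X Y < ENNReal.ofReal (2 ^ d) := by
  by_contra! hc
  have := log2_mono hc
  rw [log2_ofReal (by positivity), Real.logb_rpow two_pos (by norm_num)] at this
  exact absurd h (not_lt.2 this)

/-- An operator close to the separable substates in the Hilbert metric has a bounded ratio between
its weights on `Ψ_m` and on the complement. -/
lemma overlap_le_of_dOmegaSet_le {m : ℕ} (hm : 2 ≤ m) {δ : ℝ}
    {X : Matrix (Fin m × Fin m) (Fin m × Fin m) ℂ} (hX : X.PosSemidef)
    (h : DOmegaSet (SubSep (Fin m) (Fin m)) X ≤ δ) :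
    overlap m X ≤ 2 ^ (δ + 1) * (X.trace.re - overlap m X) := by
  have hm0 : m ≠ 0 := by omega
  -- the infimum need not be attained, hence `δ + 1` in place of `δ`
  have h1 : DOmegaSet (SubSep (Fin m) (Fin m)) X < ((δ + 1 : ℝ) : EReal) :=
    h.trans_lt (by exact_mod_cast lt_add_one δ)
  simp only [DOmegaSet, iInf_lt_iff] at h1
  obtain ⟨_, ⟨t, ht, -, σ, hσ, rfl⟩, h1⟩ := h1
  obtain ⟨γ, η, hγ, h2, h3⟩ := exists_of_omega_lt (omega_lt_of_dOmega_lt h1)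
  have hγ' : (γ : ℝ) ≤ 2 ^ (δ + 1) := by
    rw [ENNReal.ofReal, ENNReal.coe_lt_coe] at hγ
    simpa [Real.coe_toNNReal _ (by positivity : (0 : ℝ) ≤ 2 ^ (δ + 1))] using
      NNReal.coe_le_coe.2 hγ.le
  have hη : (0 : ℝ) ≤ η := η.2
  have hs := overlap_le_of_mem_sep hσ
  have ha := overlap_nonneg h2
  have hb := overlap_le_trace hm0 h3
  have htr := (isState_of_mem_sep hσ).re_trace
  simp only [map_sub, map_smul, smul_eq_mul, Matrix.trace_sub, Matrix.trace_smul, Complex.sub_re,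
    Complex.smul_re, htr] at ha hb
  have hq := overlap_le_trace hm0 hX
  have hm2 : (1 : ℝ) / m ≤ 1 / 2 := by
    have : (2 : ℝ) ≤ m := by exact_mod_cast hm
    gcongr
  have h4 : (η : ℝ) * (t * overlap m σ) ≤ η * (t * (1 - overlap m σ)) := by
    gcongr
    linarith
  calc overlap m X ≤ γ * (X.trace.re - overlap m X) := by linarith
    _ ≤ _ := by gcongr

/-- The converse bound: the error of any protocol is at least of order `1 / Ω̂_Sep(ρ^{⊗n})`. -/
lemma Distills.one_le {δ : ℝ} (hδ : 0 ≤ δ) {m : ℕ} (hm : 2 ≤ m) {ρ : Matrix (a × b) (a × b) ℂ}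
    (hρ : IsState ρ) {n : ℕ} {ε : ℝ≥0} (h : Distills δ m ρ n ε) {σ}
    (hσ : σ ∈ Sep (Fin n → a) (Fin n → b))
    {γ : ℝ} (hs : Sandwich σ (tensorPow ρ n) γ) : 1 ≤ 4 * 2 ^ (δ + 1) * γ * ε := by
  obtain ⟨k, E, i, ⟨hE, hNE⟩, htr, hF⟩ := h
  have hm0 : m ≠ 0 := by omega
  have hpos : ∀ P, P.PosSemidef → ((E i).restrictScalars ℝ P).PosSemidef :=
    fun P hP => (hE.1 i).1.map_posSemidef hP
  have hσ0 := overlap_le_of_dOmegaSet_le hm (hpos _ (isState_of_mem_sep hσ).1) (hNE i σ hσ)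
  have hR := hpos _ (isState_tensorPow hρ n).1
  have hγ := hs.one_le (isState_of_mem_sep hσ)
  obtain ⟨η, hη, h1, h2⟩ := hs.map _ hpos
  simp only [LinearMap.coe_restrictScalars] at h1 h2 hσ0 hR
  rw [fidelity_normalize_maxEnt hm0 hR] at hF
  set X := E i σ
  set R := E i (tensorPow ρ n)
  have ha := overlap_nonneg h2
  have hb := overlap_le_trace hm0 h1
  have hc := overlap_le_trace hm0 hR
  have hd := overlap_nonneg hR
  simp only [map_sub, map_smul, smul_eq_mul, Matrix.trace_sub, Matrix.trace_smul, Complex.sub_re,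
    Complex.smul_re] at ha hb
  have hG : (1 : ℝ) ≤ 2 ^ (δ + 1) := Real.one_le_rpow one_le_two (by linarith)
  set G : ℝ := 2 ^ (δ + 1)
  set p := overlap m R
  set T := R.trace.re
  have hGγ : 1 ≤ G * γ := one_le_mul_of_one_le_of_one_le hG hγ
  have hp : p ≤ G * γ * (T - p) := by
    refine le_of_mul_le_mul_left ?_ hη
    calc η * p ≤ γ * overlap m X := by linarith
      _ ≤ γ * (G * (X.trace.re - overlap m X)) := by gcongr
      _ ≤ γ * (G * (η * (T - p))) := by
        gcongr
        linarith
      _ = _ := by ring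
  -- from `1 - ε ≤ √(p / T)`, trivially so if `ε ≥ 1`
  have hF2 : 1 - 2 * ε ≤ p / T := by
    rcases le_total (ε : ℝ) 1 with hε | hε
    · have := mul_self_le_mul_self (by linarith) hF
      rw [Real.mul_self_sqrt (by positivity)] at this
      nlinarith
    · have : 0 ≤ p / T := by positivity
      linarith
  rw [le_div_iff₀ htr] at hF2
  have h5 : T ≤ (4 * G * γ * ε) * T := by
    have h6 : T - p ≤ G * γ * (T - p) := le_mul_of_one_le_left (by linarith) hGγ
    have h7 : G * γ * (T - p) ≤ G * γ * (2 * ε * T) := by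
      gcongr
      linarith
    linarith
  exact (le_mul_iff_one_le_left htr).1 h5

end Converse

/-! ### Absorbing the maximally entangled state in the separable cone -/

section SepCone
variable {ι κ : Type*} [Fintype ι] [Fintype κ]

/-- The cone of unnormalized separable operators. -/
def SepCone (ι κ : Type*) [Fintype ι] [Fintype κ] : Set (Matrix (ι × κ) (ι × κ) ℂ) :=
  {X | ∃ t : ℝ, 0 ≤ t ∧ ∃ σ ∈ Sep ι κ, X = t • σ}

lemma smul_mem_sepCone {X : Matrix (ι × κ) (ι × κ) ℂ} (hX : X ∈ SepCone ι κ) {c : ℝ} (hc : 0 ≤ c) :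
    c • X ∈ SepCone ι κ := by
  obtain ⟨t, ht, σ, hσ, rfl⟩ := hX
  exact ⟨c * t, by positivity, σ, hσ, smul_smul _ _ _⟩

lemma add_mem_sepCone {X Y : Matrix (ι × κ) (ι × κ) ℂ} (hX : X ∈ SepCone ι κ)
    (hY : Y ∈ SepCone ι κ) : X + Y ∈ SepCone ι κ := by
  obtain ⟨t, ht, σ, hσ, rfl⟩ := hX
  obtain ⟨u, hu, τ, hτ, rfl⟩ := hY
  have h : t • σ + u • τ ∈ t • Sep ι κ + u • Sep ι κ :=
    Set.add_mem_add ⟨σ, hσ, rfl⟩ ⟨τ, hτ, rfl⟩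
  rw [← convex_sep.add_smul ht hu] at h
  obtain ⟨ω, hω, h⟩ := h
  exact ⟨t + u, by positivity, ω, hω, h.symm⟩

lemma mem_sepCone_of_mem_sep {X : Matrix (ι × κ) (ι × κ) ℂ} (hX : X ∈ Sep ι κ) : X ∈ SepCone ι κ :=
  ⟨1, zero_le_one, X, hX, (one_smul _ _).symm⟩

lemma mem_subSep_of_mem_sepCone {X : Matrix (ι × κ) (ι × κ) ℂ} (hX : X ∈ SepCone ι κ)
    (h : X.trace.re ≤ 1) : X ∈ SubSep ι κ := by
  obtain ⟨t, ht, σ, hσ, rfl⟩ := hX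
  refine ⟨t, ht, ?_, σ, hσ, rfl⟩
  simpa [Matrix.trace_smul, (isState_of_mem_sep hσ).2] using h

lemma sep_nonempty [Nonempty ι] [Nonempty κ] : (Sep ι κ).Nonempty := by
  classical
  exact ⟨_, kronecker_mem_sep (isState_single (Classical.arbitrary ι))
    (isState_single (Classical.arbitrary κ))⟩

lemma zero_mem_sepCone [Nonempty ι] [Nonempty κ] : 0 ∈ SepCone ι κ := by
  obtain ⟨σ, hσ⟩ := sep_nonempty (ι := ι) (κ := κ)
  exact ⟨0, le_rfl, σ, hσ, (zero_smul _ _).symm⟩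

lemma sum_mem_sepCone [Nonempty ι] [Nonempty κ] {J : Type*} (s : Finset J)
    {X : J → Matrix (ι × κ) (ι × κ) ℂ} (hX : ∀ j, X j ∈ SepCone ι κ) : ∑ j ∈ s, X j ∈ SepCone ι κ :=
  Finset.sum_induction _ (· ∈ SepCone ι κ) (fun _ _ => add_mem_sepCone) zero_mem_sepCone
    fun j _ => hX j

lemma exists_smul_isState {X : Matrix ι ι ℂ} (hX : X.PosSemidef) (h : X ≠ 0) :
    ∃ t : ℝ, 0 ≤ t ∧ ∃ α, IsState α ∧ X = t • α := by
  have h0 := PosSemidef.re_trace_nonneg hX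
  have h1 : X.trace.re ≠ 0 := by
    intro h2
    have := PosSemidef.trace_eq_re hX
    rw [h2, Complex.ofReal_zero] at this
    exact h (hX.trace_eq_zero_iff.1 this)
  refine ⟨X.trace.re, h0, X.trace.re⁻¹ • X, ⟨hX.smul (inv_nonneg.2 h0), ?_⟩, ?_⟩
  · rw [Matrix.trace_smul, ← Complex.coe_smul, smul_eq_mul, Complex.ofReal_inv,
      ← PosSemidef.trace_eq_re hX, inv_mul_cancel₀]
    intro h2
    simp [h2] at h1
  · rw [smul_smul, mul_inv_cancel₀ h1, one_smul]

lemma kronecker_mem_sepCone [Nonempty ι] [Nonempty κ] {α : Matrix ι ι ℂ} {β : Matrix κ κ ℂ}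
    (hα : α.PosSemidef) (hβ : β.PosSemidef) : α ⊗ₖ β ∈ SepCone ι κ := by
  by_cases h : α = 0
  · simpa [h] using zero_mem_sepCone
  by_cases h' : β = 0
  · simpa [h'] using zero_mem_sepCone
  obtain ⟨t, ht, α, h1, rfl⟩ := exists_smul_isState hα h
  obtain ⟨u, hu, β, h2, rfl⟩ := exists_smul_isState hβ h'
  exact ⟨t * u, by positivity, _, kronecker_mem_sep h1 h2, by
    rw [Matrix.smul_kronecker, Matrix.kronecker_smul, smul_smul]⟩

/-- The unnormalized product state of the vector `(e + ω f) ⊗ (e + ω̄ f)`. -/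
def phaseState (e f : ι → ℂ) (ω : ℂ) : Matrix (ι × ι) (ι × ι) ℂ :=
  vecMulVec (e + ω • f) (star (e + ω • f)) ⊗ₖ
    vecMulVec (e + star ω • f) (star (e + star ω • f))

/-- Averaging the phase over the fourth roots of unity leaves only the phase-free terms. -/
lemma sum_phaseState (e f : ι → ℂ) :
    phaseState e f 1 + phaseState e f (-1) + phaseState e f Complex.I +
        phaseState e f (-Complex.I) =
      (4 : ℝ) • ((vecMulVec e (star e) + vecMulVec f (star f)) ⊗ₖ
          (vecMulVec e (star e) + vecMulVec f (star f)) +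
        vecMulVec e (star f) ⊗ₖ vecMulVec e (star f) +
        vecMulVec f (star e) ⊗ₖ vecMulVec f (star e)) := by
  ext ⟨p, q⟩ ⟨r, s⟩
  simp [phaseState, Matrix.vecMulVec_apply]
  ring_nf
  simp [Complex.I_sq, Complex.I_pow_four]
  ring

/-- The expansion `m Ψ_m = ∑ |k⟩⟨l| ⊗ |k⟩⟨l|`. -/
lemma sum_single_kronecker_single (m : ℕ) (hm : m ≠ 0) :
    ∑ k : Fin m, ∑ l : Fin m, vecMulVec (Pi.single k (1 : ℂ)) (star (Pi.single l 1)) ⊗ₖ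
      vecMulVec (Pi.single k (1 : ℂ)) (star (Pi.single l 1)) = (m : ℝ) • maxEnt m := by
  have h : (m : ℂ) * (((Real.sqrt m : ℂ))⁻¹ * ((Real.sqrt m : ℂ))⁻¹) = 1 := by
    have hm' : (m : ℂ) ≠ 0 := by exact_mod_cast hm
    rw [← mul_inv, ← Complex.ofReal_mul, Real.mul_self_sqrt m.cast_nonneg, Complex.ofReal_natCast,
      mul_inv_cancel₀ hm']
  ext ⟨p, q⟩ ⟨r, s⟩
  simp [Matrix.sum_apply, Matrix.vecMulVec_apply, Pi.single_apply, maxEnt, maxEntVec]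
  split_ifs <;> simp [h]

/-- A multiple of a suitable separable state absorbs the entanglement of `Ψ_m`. -/
lemma exists_add_maxEnt_mem_sepCone {m : ℕ} (hm : m ≠ 0) :
    ∃ τ ∈ Sep (Fin m) (Fin m), ∃ C : ℝ, 0 < C ∧ maxEnt m + C • τ ∈ SepCone (Fin m) (Fin m) := by
  have : Nonempty (Fin m) := ⟨⟨0, Nat.pos_of_ne_zero hm⟩⟩
  let e : Fin m → Fin m → ℂ := fun k => Pi.single k 1
  let Q : Fin m → Fin m → Matrix (Fin m) (Fin m) ℂ := fun k l =>
    vecMulVec (e k) (star (e k)) + vecMulVec (e l) (star (e l))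
  have hQ (k l) : (Q k l).PosSemidef :=
    (Matrix.posSemidef_vecMulVec_self_star _).add (Matrix.posSemidef_vecMulVec_self_star _)
  have hph (k l ω) : phaseState (e k) (e l) ω ∈ SepCone (Fin m) (Fin m) :=
    kronecker_mem_sepCone (Matrix.posSemidef_vecMulVec_self_star _)
      (Matrix.posSemidef_vecMulVec_self_star _)
  have hS : ∑ k, ∑ l, Q k l ⊗ₖ Q k l ∈ SepCone (Fin m) (Fin m) :=
    sum_mem_sepCone _ fun k => sum_mem_sepCone _ fun l => kronecker_mem_sepCone (hQ k l) (hQ k l)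
  have hT : ∑ k, ∑ l, (4 : ℝ) • (Q k l ⊗ₖ Q k l +
        vecMulVec (e k) (star (e l)) ⊗ₖ vecMulVec (e k) (star (e l)) +
        vecMulVec (e l) (star (e k)) ⊗ₖ vecMulVec (e l) (star (e k))) ∈
      SepCone (Fin m) (Fin m) := by
    refine sum_mem_sepCone _ fun k => sum_mem_sepCone _ fun l => ?_
    rw [← sum_phaseState]
    exact add_mem_sepCone (add_mem_sepCone (add_mem_sepCone (hph ..) (hph ..)) (hph ..)) (hph ..)
  have h1 := sum_single_kronecker_single m hm
  have h2 := h1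
  rw [Finset.sum_comm] at h2
  simp only [← Finset.smul_sum, Finset.sum_add_distrib] at hT
  rw [h1, h2] at hT
  have hm' : (0 : ℝ) < m := by positivity
  have hT' := smul_mem_sepCone hT (c := 1 / (8 * m)) (by positivity)
  obtain ⟨t, ht, τ, hτ, hS⟩ := hS
  rw [hS] at hT'
  -- the summand `1` keeps the constant positive
  refine ⟨τ, hτ, t / (2 * m) + 1, by positivity, ?_⟩
  have h3 : maxEnt m + (t / (2 * m) + 1) • τ =
      (1 / (8 * m) : ℝ) • (4 : ℝ) • (t • τ + (m : ℝ) • maxEnt m + (m : ℝ) • maxEnt m) + τ := by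
    ext i j
    simp
    field_simp
    ring
  rw [h3]
  exact add_mem_sepCone hT' (mem_sepCone_of_mem_sep hτ)

end SepCone

/-! ### Positive functionals -/

section Functional
variable {ι κ : Type*}

/-- Positive functionals on a matrix algebra: Hermitian, and nonnegative on positive semidefinite
matrices. -/
def IsPosFunctional {ι : Type*} (φ : Matrix ι ι ℂ →ₗ[ℂ] ℂ) : Prop :=
  (∀ P, P.PosSemidef → 0 ≤ φ P) ∧ ∀ X, φ Xᴴ = star (φ X)

lemma isPosFunctional_trace [Fintype ι] : IsPosFunctional (Matrix.traceLinearMap ι ℂ ℂ) :=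
  ⟨fun _ hP => hP.trace_nonneg, fun X => Matrix.trace_conjTranspose X⟩

lemma IsPosFunctional.eq_re {φ : Matrix ι ι ℂ →ₗ[ℂ] ℂ} (hφ : IsPosFunctional φ) {P : Matrix ι ι ℂ}
    (hP : P.PosSemidef) : φ P = ((φ P).re : ℂ) := by
  have h := hφ.1 P hP
  rw [Complex.le_def] at h
  apply Complex.ext <;> simp [← h.2]

lemma IsPosFunctional.re_nonneg {φ : Matrix ι ι ℂ →ₗ[ℂ] ℂ} (hφ : IsPosFunctional φ)
    {P : Matrix ι ι ℂ} (hP : P.PosSemidef) : 0 ≤ (φ P).re := (Complex.le_def.1 (hφ.1 P hP)).1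

/-- A positive functional is dominated by a multiple of the trace. -/
lemma IsPosFunctional.re_le [Fintype ι] [DecidableEq ι] {φ : Matrix ι ι ℂ →ₗ[ℂ] ℂ}
    (hφ : IsPosFunctional φ)
    {P : Matrix ι ι ℂ} (hP : P.PosSemidef) : (φ P).re ≤ (φ 1).re * P.trace.re := by
  have := hφ.re_nonneg (posSemidef_trace_smul_one_sub hP)
  rw [map_sub, ← Complex.coe_smul, map_smul, smul_eq_mul, Complex.sub_re,
    Complex.re_ofReal_mul] at this
  linarith

/-- A real functional that is nonnegative on positive semidefinite matrices agrees on Hermitian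
matrices with a positive functional. -/
lemma exists_isPosFunctional (g : Matrix ι ι ℂ →ₗ[ℝ] ℝ) (hg : ∀ P, P.PosSemidef → 0 ≤ g P) :
    ∃ φ : Matrix ι ι ℂ →ₗ[ℂ] ℂ, IsPosFunctional φ ∧ ∀ X, X.IsHermitian → φ X = g X := by
  let ct : Matrix ι ι ℂ →ₗ[ℝ] Matrix ι ι ℂ :=
    { toFun := fun X => Xᴴ
      map_add' := fun X Y => Matrix.conjTranspose_add X Y
      map_smul' := fun c X => by simp [Matrix.conjTranspose_smul] }
  -- symmetrizing under `X ↦ Xᴴ` makes the complex extension real on Hermitian matrices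
  let g' : Module.Dual ℝ (Matrix ι ι ℂ) := (1 / 2 : ℝ) • (g + g ∘ₗ ct)
  have hg' (X) : g' X = (g X + g Xᴴ) / 2 := by
    simp [g', ct]
    ring
  have hct (X) : g' Xᴴ = g' X := by
    rw [hg', hg', Matrix.conjTranspose_conjTranspose, add_comm]
  let φ : Matrix ι ι ℂ →ₗ[ℂ] ℂ := Module.Dual.extendRCLike (𝕜 := ℂ) g'
  have hφ (X) : φ X = (g' X : ℂ) - Complex.I * (g' (Complex.I • X) : ℂ) :=
    Module.Dual.extendRCLike_apply (𝕜 := ℂ) g' X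
  have hI (X) : g' (Complex.I • Xᴴ) = - g' (Complex.I • X) := by
    rw [← hct, Matrix.conjTranspose_smul, Matrix.conjTranspose_conjTranspose, ← map_neg]
    congr 1
    simp
  have hH (X : Matrix ι ι ℂ) (hX : X.IsHermitian) : φ X = g X := by
    have h1 := hI X
    rw [hX.eq] at h1
    have h2 : g' (Complex.I • X) = 0 := by linarith
    have h3 : g' X = g X := by
      rw [hg', hX.eq]
      ring
    rw [hφ, h2, h3]
    simp
  refine ⟨φ, ⟨fun P hP => ?_, fun X => ?_⟩, hH⟩
  · rw [hH P hP.1]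
    exact_mod_cast hg P hP
  · rw [hφ, hφ, hct, hI]
    simp

/-- Measure-and-prepare maps `X ↦ φ(X) M` are completely positive. -/
lemma IsPosFunctional.isCP_smulRight [Fintype ι] [Fintype κ]
    {φ : Matrix ι ι ℂ →ₗ[ℂ] ℂ} (hφ : IsPosFunctional φ)
    {M : Matrix κ κ ℂ} (hM : M.PosSemidef) : IsCP (φ.smulRight M) := by
  classical
  intro k X hX
  let B : Matrix (Fin k) (Fin k) ℂ := Matrix.of fun s t => φ (Matrix.of fun x y => X (s, x) (t, y))
  have h : ampliation k (φ.smulRight M) X = B ⊗ₖ M := by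
    ext s t
    simp [ampliation, B]
  rw [h]
  refine Matrix.PosSemidef.kronecker
    (Matrix.PosSemidef.of_dotProduct_mulVec_nonneg ?_ fun v => ?_) hM
  · ext s t
    simp only [B, Matrix.conjTranspose_apply, Matrix.of_apply]
    rw [← hφ.2]
    congr 1
    ext x y
    exact hX.1.apply (s, x) (t, y)
  · -- the quadratic form of `B` is the value of `φ` at a compression of `X`
    let V : Matrix (Fin k × ι) ι ℂ := Matrix.of fun p x => if p.2 = x then v p.1 else 0
    have hV : star v ⬝ᵥ B *ᵥ v = φ (Vᴴ * X * V) := by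
      have h1 : Vᴴ * X * V =
          ∑ s, ∑ t, (star (v s) * v t) • Matrix.of fun x y => X (s, x) (t, y) := by
        ext x y
        simp [Matrix.mul_apply, V, Fintype.sum_prod_type, Matrix.sum_apply, apply_ite star]
        rw [Finset.sum_comm' (t' := Finset.univ) (s' := fun _ => Finset.univ) (by simp)]
        refine Finset.sum_congr rfl fun t _ => ?_
        rw [Finset.sum_mul]
        refine Finset.sum_congr rfl fun s _ => ?_
        ring
      rw [h1]
      simp only [map_sum, map_smul, dotProduct, Matrix.mulVec, Finset.mul_sum, B, Matrix.of_apply,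
        smul_eq_mul, Pi.star_apply]
      refine Finset.sum_congr rfl fun s _ => Finset.sum_congr rfl fun t _ => ?_
      ring
    rw [hV]
    exact hφ.1 _ (hX.conjTranspose_mul_mul_same V)

lemma IsCP.add {E F : Matrix ι ι ℂ →ₗ[ℂ] Matrix κ κ ℂ} (hE : IsCP E) (hF : IsCP F) : IsCP (E + F) :=
  fun k X hX => (hE k X hX).add (hF k X hX)

end Functional

/-! ### Duality -/

section Duality
variable {ι κ : Type*} [Fintype ι] [Fintype κ]

/-- Conic duality for the Hilbert metric: if no separable state is within `γ` of `ρ`, a pair of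
positive functionals witnesses it. -/
lemma exists_dual_witness {ρ : Matrix (ι × κ) (ι × κ) ℂ} (hρ : IsState ρ) {γ : ℝ}
    (h : ∀ σ ∈ Sep ι κ, ¬ Sandwich σ ρ γ) :
    ∃ A B : Matrix (ι × κ) (ι × κ) ℂ →ₗ[ℂ] ℂ, IsPosFunctional A ∧ IsPosFunctional B ∧
      (∀ σ ∈ Sep ι κ, γ * (A σ).re ≤ (B σ).re) ∧ (B ρ).re < (A ρ).re := by
  have hne : Nonempty (ι × κ) := by
    by_contra hc
    rw [not_nonempty_iff] at hc
    have := hρ.2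
    simp [Matrix.trace] at this
  have : Nonempty ι := hne.map Prod.fst
  have : Nonempty κ := hne.map Prod.snd
  let M := Matrix (ι × κ) (ι × κ) ℂ
  have : LocallyConvexSpace ℝ M :=
    inferInstanceAs (LocallyConvexSpace ℝ (ι × κ → ι × κ → ℂ))
  let T : M →ₗ[ℝ] M × M := LinearMap.id.prod ((-γ) • LinearMap.id)
  have hT (X : M) : T X = (X, -(γ • X)) := by simp [T]
  let D : Set (M × M) := {p | (ρ - p.1).PosSemidef ∧ (-ρ - p.2).PosSemidef}
  have hDc : Convex ℝ D := by
    rintro ⟨X, Y⟩ ⟨hX, hY⟩ ⟨X', Y'⟩ ⟨hX', hY'⟩ s t hs ht hst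
    have e (Z W W' : M) : Z - (s • W + t • W') = s • (Z - W) + t • (Z - W') := by
      rw [smul_sub, smul_sub, ← sub_eq_zero]
      nth_rewrite 1 [← one_smul ℝ Z]
      rw [← hst]
      module
    refine ⟨?_, ?_⟩
    · change (ρ - (s • X + t • X')).PosSemidef
      rw [e]
      exact (hX.smul hs).add (hX'.smul ht)
    · change (-ρ - (s • Y + t • Y')).PosSemidef
      rw [e]
      exact (hY.smul hs).add (hY'.smul ht)
  have hDcl : IsClosed D :=
    (isClosed_posSemidef.preimage (continuous_const.sub continuous_fst)).inter
      (isClosed_posSemidef.preimage (continuous_const.sub continuous_snd))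
  have hdisj : Disjoint (T '' SubSep ι κ) D := by
    rw [Set.disjoint_left]
    rintro _ ⟨_, ⟨t, ht, -, σ, hσ, rfl⟩, rfl⟩ ⟨h1, h2⟩
    rw [hT] at h1 h2
    simp only [sub_neg_eq_add, neg_add_eq_sub] at h1 h2
    have ht0 : t ≠ 0 := by
      rintro rfl
      have := PosSemidef.re_trace_nonneg h2
      simp [hρ.2] at this
      linarith
    have htp : 0 < t := lt_of_le_of_ne ht ht0.symm
    refine h σ hσ ⟨t⁻¹, inv_pos.2 htp, ?_, ?_⟩
    · have := h1.smul (inv_pos.2 htp).le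
      rwa [smul_sub, smul_smul, inv_mul_cancel₀ ht0, one_smul] at this
    · have := h2.smul (inv_pos.2 htp).le
      rwa [smul_sub, smul_smul, smul_smul, mul_right_comm, inv_mul_cancel₀ ht0, one_mul] at this
  -- `D` consists of the pairs below `(ρ, -ρ)`, so it meets the pairs `(X, -γ X)` exactly when
  -- `X ≤ ρ ≤ γ X`
  obtain ⟨f, u, v, hu, huv, hv⟩ := geometric_hahn_banach_compact_closed
    (convex_subSep.linear_image T) (isCompact_subSep.image T.continuous_of_finiteDimensional)
    hDc hDcl hdisj
  let f₁ : M →ₗ[ℝ] ℝ := f.toLinearMap ∘ₗ LinearMap.inl ℝ M M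
  let f₂ : M →ₗ[ℝ] ℝ := f.toLinearMap ∘ₗ LinearMap.inr ℝ M M
  have hf (X Y : M) : f (X, Y) = f₁ X + f₂ Y := by
    simp [f₁, f₂, ← map_add]
  obtain ⟨σ₀, hσ₀⟩ := sep_nonempty (ι := ι) (κ := κ)
  have hu0 : 0 < u := by
    have := hu 0 ⟨0, ⟨0, le_rfl, zero_le_one, σ₀, hσ₀, (zero_smul _ _).symm⟩, map_zero T⟩
    simpa using this
  have hvρ : v < f₁ ρ - f₂ ρ := by
    have := hv (ρ, -ρ)
      ⟨by simpa using Matrix.PosSemidef.zero, by simpa using Matrix.PosSemidef.zero⟩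
    rwa [hf, map_neg, ← sub_eq_add_neg] at this
  -- a functional bounded below on a cone is nonnegative there
  have hcone (r x : ℝ) (hr : ∀ s : ℝ, 0 ≤ s → v < r - s * x) : x ≤ 0 := by
    by_contra! hx
    have h1 := hr (|r - v| / x) (by positivity)
    rw [div_mul_cancel₀ _ hx.ne'] at h1
    linarith [le_abs_self (r - v)]
  have hf₁ (P : M) (hP : P.PosSemidef) : f₁ P ≤ 0 := by
    refine hcone (f₁ ρ - f₂ ρ) _ fun s hs => ?_
    have := hv (ρ - s • P, -ρ) ⟨by simpa using hP.smul hs, by simpa using Matrix.PosSemidef.zero⟩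
    rw [hf, map_sub, map_smul, map_neg, smul_eq_mul] at this
    linarith
  have hf₂ (P : M) (hP : P.PosSemidef) : f₂ P ≤ 0 := by
    refine hcone (f₁ ρ - f₂ ρ) _ fun s hs => ?_
    have := hv (ρ, -ρ - s • P) ⟨by simpa using Matrix.PosSemidef.zero, by simpa using hP.smul hs⟩
    rw [hf, map_sub, map_smul, map_neg, smul_eq_mul] at this
    linarith
  obtain ⟨A, hA, hA'⟩ := exists_isPosFunctional (-f₂) fun P hP => by simpa using hf₂ P hP
  -- subtracting `u` times the trace turns the affine separation into a homogeneous one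
  obtain ⟨B, hB, hB'⟩ := exists_isPosFunctional
    (u • (Complex.reLm ∘ₗ (Matrix.traceLinearMap (ι × κ) ℂ ℂ).restrictScalars ℝ) - f₁)
    fun P hP => by
      have := PosSemidef.re_trace_nonneg hP
      have h1 := hf₁ P hP
      have h2 : 0 ≤ u * P.trace.re := by positivity
      simp
      linarith
  refine ⟨A, B, hA, hB, fun σ hσ => ?_, ?_⟩
  · have h1 := hu (T σ) ⟨σ, ⟨1, zero_le_one, le_rfl, σ, hσ, (one_smul _ _).symm⟩, rfl⟩
    rw [hT, hf, map_neg, map_smul, smul_eq_mul] at h1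
    have hs := isState_of_mem_sep hσ
    rw [hA' σ hs.1.1, hB' σ hs.1.1]
    simp [hs.2]
    linarith
  · rw [hA' ρ hρ.1.1, hB' ρ hρ.1.1]
    simp [hρ.2]
    linarith

end Duality

/-! ### Achieving the error -/

section Achievability
variable {ι κ : Type*} [Fintype ι] [Fintype κ]

lemma dOmegaSet_le_of_mem [DecidableEq ι] {F : Set (Matrix ι ι ℂ)} {X : Matrix ι ι ℂ}
    (hX : X.PosSemidef) (h : X ∈ F) {δ : ℝ} (hδ : 0 ≤ δ) : DOmegaSet F X ≤ δ := by
  refine iInf₂_le_of_le X h ?_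
  have h1 : Omega X X ≤ ENNReal.ofReal 1 := by
    refine (Sandwich.omega_le (γ := 1) hX hX ⟨1, one_pos, ?_, ?_⟩).trans (by simp)
    · simpa using Matrix.PosSemidef.zero
    · simpa using Matrix.PosSemidef.zero
  refine (log2_mono h1).trans ?_
  rw [log2_ofReal one_pos, Real.logb_one]
  exact_mod_cast hδ

lemma maxEnt_isState {m : ℕ} (hm : m ≠ 0) : IsState (maxEnt m) :=
  ⟨Matrix.posSemidef_vecMulVec_self_star _, by
    rw [maxEnt, Matrix.trace_vecMulVec, dotProduct_comm, maxEntVec_unit hm]⟩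

lemma overlap_maxEnt {m : ℕ} (hm : m ≠ 0) : overlap m (maxEnt m) = 1 := by
  rw [overlap_apply, maxEnt, Matrix.vecMulVec_mulVec, maxEntVec_unit hm]
  simp [maxEntVec_unit hm]

/-- A two-outcome measure-and-prepare instrument built from positive functionals `A`, `B`: the
first outcome prepares `A(X) Ψ + B(X) τ`, the second one prepares `τ`. -/
lemma exists_instrument [DecidableEq ι] [DecidableEq κ] {m : ℕ} (hm : m ≠ 0)
    {τ : Matrix (Fin m × Fin m) (Fin m × Fin m) ℂ} (hτ : τ ∈ Sep (Fin m) (Fin m)) {C : ℝ}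
    (hΨ : maxEnt m + C • τ ∈ SepCone (Fin m) (Fin m)) {δ : ℝ} (hδ : 0 ≤ δ)
    {A B : Matrix (ι × κ) (ι × κ) ℂ →ₗ[ℂ] ℂ} (hA : IsPosFunctional A) (hB : IsPosFunctional B)
    (hAB : ∀ σ ∈ Sep ι κ, C * (A σ).re ≤ (B σ).re)
    (hle : ∀ P, P.PosSemidef → (A P).re + (B P).re ≤ P.trace.re) :
    IsNE δ ![A.smulRight (maxEnt m) + B.smulRight τ,
      (Matrix.traceLinearMap (ι × κ) ℂ ℂ - A - B).smulRight τ] := by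
  have hτs := isState_of_mem_sep hτ
  have hΨs := maxEnt_isState hm
  have hD : IsPosFunctional (Matrix.traceLinearMap (ι × κ) ℂ ℂ - A - B) := by
    refine ⟨fun P hP => ?_, fun X => ?_⟩
    · simp only [LinearMap.sub_apply]
      rw [isPosFunctional_trace.eq_re hP, hA.eq_re hP, hB.eq_re hP]
      have := hle P hP
      have h2 : 0 ≤ P.trace.re - (A P).re - (B P).re := by linarith
      exact_mod_cast h2
    · simp only [LinearMap.sub_apply, isPosFunctional_trace.2, hA.2, hB.2, star_sub]
  have hcp1 : IsCP (A.smulRight (maxEnt m) + B.smulRight τ) :=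
    (hA.isCP_smulRight hΨs.1).add (hB.isCP_smulRight hτs.1)
  have hcp2 := hD.isCP_smulRight hτs.1
  have htr1 (X) : ((A.smulRight (maxEnt m) + B.smulRight τ) X).trace = A X + B X := by
    simp [Matrix.trace_add, Matrix.trace_smul, hΨs.2, hτs.2]
  have htr2 (X) : (((Matrix.traceLinearMap (ι × κ) ℂ ℂ - A - B).smulRight τ) X).trace =
      X.trace - A X - B X := by
    simp [Matrix.trace_smul, hτs.2]
  refine ⟨⟨fun i => ?_, ?_⟩, fun i σ hσ => ?_⟩
  · fin_cases i
    · refine ⟨hcp1, fun X hX => ?_⟩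
      simp only [Fin.zero_eta, Matrix.cons_val_zero, htr1, Complex.add_re]
      exact hle X hX
    · refine ⟨hcp2, fun X hX => ?_⟩
      simp only [Fin.mk_one, Matrix.cons_val_one, Matrix.cons_val_fin_one, htr2, Complex.sub_re]
      linarith [hA.re_nonneg hX, hB.re_nonneg hX]
  · rw [Fin.sum_univ_two]
    simp only [Matrix.cons_val_zero, Matrix.cons_val_one, Matrix.cons_val_fin_one]
    refine ⟨hcp1.add hcp2, fun X => ?_⟩
    rw [LinearMap.add_apply, Matrix.trace_add, htr1, htr2]
    ring
  · have hs := isState_of_mem_sep hσ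
    have ha := hA.re_nonneg hs.1
    have hb := hB.re_nonneg hs.1
    have hl := hle σ hs.1
    rw [hs.re_trace] at hl
    fin_cases i
    · refine dOmegaSet_le_of_mem (hcp1.map_posSemidef hs.1) ?_ hδ
      refine mem_subSep_of_mem_sepCone ?_ ?_
      · have e : (A.smulRight (maxEnt m) + B.smulRight τ) σ =
            (A σ).re • (maxEnt m + C • τ) + ((B σ).re - C * (A σ).re) • τ := by
          rw [LinearMap.add_apply, LinearMap.smulRight_apply, LinearMap.smulRight_apply,
            hA.eq_re hs.1, hB.eq_re hs.1, Complex.coe_smul, Complex.coe_smul, Complex.ofReal_re,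
            Complex.ofReal_re]
          module
        exact e ▸ add_mem_sepCone (smul_mem_sepCone hΨ ha)
          (smul_mem_sepCone (mem_sepCone_of_mem_sep hτ) (by linarith [hAB σ hσ]))
      · exact (htr1 σ).symm ▸ hl
    · refine dOmegaSet_le_of_mem (hcp2.map_posSemidef hs.1) ?_ hδ
      refine mem_subSep_of_mem_sepCone ?_ ?_
      · have e : ((Matrix.traceLinearMap (ι × κ) ℂ ℂ - A - B).smulRight τ) σ =
            ((Matrix.traceLinearMap (ι × κ) ℂ ℂ - A - B) σ).re • τ := by
          rw [LinearMap.smulRight_apply, hD.eq_re hs.1, Complex.coe_smul, Complex.ofReal_re]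
        exact e ▸ smul_mem_sepCone (mem_sepCone_of_mem_sep hτ) (hD.re_nonneg hs.1)
      · have := htr2 σ
        simp only [this, Complex.sub_re, hs.re_trace]
        linarith

variable {a b : Type*} [Fintype a] [DecidableEq a] [Fintype b] [DecidableEq b]

/-- Achievability: every error of order `1 / γ` with `γ < Ω̂_Sep(ρ^{⊗n})` is attained. -/
lemma exists_distills {m : ℕ} (hm : m ≠ 0) {δ : ℝ} (hδ : 0 ≤ δ) {ρ : Matrix (a × b) (a × b) ℂ}
    (hρ : IsState ρ) : ∃ C : ℝ≥0, 0 < C ∧ ∀ (n : ℕ) (γ : ℝ≥0), 0 < γ →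
      (γ : ℝ≥0∞) < OmegaHat (Sep (Fin n → a) (Fin n → b)) (tensorPow ρ n) →
      Distills δ m ρ n (C / γ) := by
  obtain ⟨τ, hτ, C, hC, hΨ⟩ := exists_add_maxEnt_mem_sepCone hm
  lift C to ℝ≥0 using hC.le
  refine ⟨C, by exact_mod_cast hC, fun n γ hγ hlt => ?_⟩
  have hR := isState_tensorPow hρ n
  set R := tensorPow ρ n
  obtain ⟨A, B, hA, hB, hAB, hlt'⟩ := exists_dual_witness (γ := (γ : ℝ)) hR fun σ hσ hs =>
    absurd (hs.omegaHat_le hR.1 hσ) (not_le.2 hlt)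
  have hγ' : (0 : ℝ) < γ := hγ
  have hA1 := hA.re_nonneg Matrix.PosSemidef.one
  have hB1 := hB.re_nonneg Matrix.PosSemidef.one
  -- `s` makes the instrument trace nonincreasing
  let s : ℝ := (1 + γ * (A 1).re + C * (B 1).re)⁻¹
  have hs : 0 < s := by positivity
  have hsmul {φ : Matrix ((Fin n → a) × (Fin n → b)) ((Fin n → a) × (Fin n → b)) ℂ →ₗ[ℂ] ℂ}
      (hφ : IsPosFunctional φ) {c : ℝ} (hc : 0 ≤ c) : IsPosFunctional ((c : ℂ) • φ) := by
    refine ⟨fun P hP => ?_, fun X => by simp [hφ.2]⟩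
    rw [LinearMap.smul_apply, hφ.eq_re hP, smul_eq_mul]
    exact_mod_cast mul_nonneg hc (hφ.re_nonneg hP)
  have hA' := hsmul hA (c := s * γ) (by positivity)
  have hB' := hsmul hB (c := s * C) (by positivity)
  have hNE := exists_instrument hm hτ hΨ hδ hA' hB' (fun σ hσ => by
    have h1 := mul_le_mul_of_nonneg_left (hAB σ hσ) (by positivity : 0 ≤ s * C)
    rw [LinearMap.smul_apply, LinearMap.smul_apply, smul_eq_mul, smul_eq_mul,
      Complex.re_ofReal_mul, Complex.re_ofReal_mul]
    linarith) (fun P hP => by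
    have h1 := hA.re_le hP
    have h2 := hB.re_le hP
    have h0 := PosSemidef.re_trace_nonneg hP
    rw [LinearMap.smul_apply, LinearMap.smul_apply, smul_eq_mul, smul_eq_mul,
      Complex.re_ofReal_mul, Complex.re_ofReal_mul]
    have h3 : s * (1 + γ * (A 1).re + C * (B 1).re) = 1 := inv_mul_cancel₀ (by positivity)
    calc s * γ * (A P).re + s * C * (B P).re
        ≤ s * γ * ((A 1).re * P.trace.re) + s * C * ((B 1).re * P.trace.re) := by gcongr
      _ = (s * (1 + γ * (A 1).re + C * (B 1).re) - s) * P.trace.re := by ring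
      _ ≤ P.trace.re := by
        rw [h3]
        nlinarith)
  have hτs := isState_of_mem_sep hτ
  have hΨs := maxEnt_isState hm
  have hAp := (hB.re_nonneg hR.1).trans_lt hlt'
  have hBp := hB.re_nonneg hR.1
  set p := (A R).re
  set q := (B R).re
  have hX : (((s * γ : ℝ) : ℂ) • A).smulRight (maxEnt m) R + (((s * C : ℝ) : ℂ) • B).smulRight τ R =
      (s * γ * p) • maxEnt m + (s * C * q) • τ := by
    rw [LinearMap.smulRight_apply, LinearMap.smulRight_apply, LinearMap.smul_apply,
      LinearMap.smul_apply, hA.eq_re hR.1, hB.eq_re hR.1, smul_eq_mul, smul_eq_mul,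
      ← Complex.ofReal_mul, ← Complex.ofReal_mul, Complex.coe_smul, Complex.coe_smul]
  have hXp : ((s * γ * p) • maxEnt m + (s * C * q) • τ).PosSemidef :=
    (hΨs.1.smul (by positivity)).add (hτs.1.smul (by positivity))
  have htr : ((s * γ * p) • maxEnt m + (s * C * q) • τ).trace.re = s * γ * p + s * C * q := by
    simp [Matrix.trace_add, Matrix.trace_smul, hΨs.2, hτs.2]
  refine ⟨2, _, 0, hNE, ?_, ?_⟩
  · simp only [Matrix.cons_val_zero, LinearMap.add_apply]
    rw [hX, htr]
    positivity
  · simp only [Matrix.cons_val_zero, LinearMap.add_apply]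
    rw [hX, fidelity_normalize_maxEnt hm hXp, htr, map_add, map_smul, map_smul, overlap_maxEnt hm,
      smul_eq_mul, smul_eq_mul, mul_one]
    have ho := overlap_nonneg hτs.1
    have hx : 1 - C / γ ≤ s * γ * p / (s * γ * p + s * C * q) := by
      rw [le_div_iff₀ (by positivity), sub_mul, sub_le_iff_le_add, one_mul]
      have : s * C * q ≤ C / γ * (s * γ * p) := by
        have : C / γ * (s * γ * p) = s * C * p := by field_simp
        rw [this]
        gcongr
      have h0 : 0 ≤ C / γ * (s * C * q) := by positivity
      linarith
    have hx1 : s * γ * p / (s * γ * p + s * C * q) ≤ 1 :=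
      div_le_one_of_le₀ (by nlinarith [mul_nonneg (mul_nonneg hs.le hC.le) hBp]) (by positivity)
    have hx0 : 0 ≤ s * γ * p / (s * γ * p + s * C * q) := by positivity
    refine le_trans (b := s * γ * p / (s * γ * p + s * C * q)) (by rw [NNReal.coe_div]; exact hx) ?_
    refine Real.le_sqrt_of_sq_le ?_
    refine (pow_le_of_le_one hx0 hx1 two_ne_zero).trans ?_
    gcongr
    have : 0 ≤ s * C * q * overlap m τ := by positivity
    linarith

end Achievability

/-! ### The distillation exponent -/

section Exponent
variable {a b : Type*} [Fintype a] [DecidableEq a] [Fintype b] [DecidableEq b]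

lemma coe_mul_log2_ofReal (n : ℕ) {x : ℝ} (hx : 0 < x) :
    ((1 / n : ℝ) : EReal) * log2 (ENNReal.ofReal x) = ((Real.logb 2 x / n : ℝ) : EReal) := by
  rw [log2_ofReal hx, ← EReal.coe_mul]
  congr 1
  ring

/-- The error bound `1 ≤ 4 * 2 ^ (δ + 1) * Ω n * ε n` in the limit. -/
lemma distExponentAt_le {ρ : Matrix (a × b) (a × b) ℂ} (hρ : IsState ρ) {δ : ℝ} (hδ : 0 ≤ δ) {m : ℕ}
    (hm : 2 ≤ m) {R : EReal} (hR : Tendsto (regSeq ρ) atTop (𝓝 R)) : distExponentAt δ m ρ ≤ R := by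
  refine sSup_le ?_
  rintro L ⟨ε, hε, hL⟩
  set K : ℝ := 4 * 2 ^ (δ + 1)
  have hK : 0 < K := by positivity
  have hK0 : Tendsto (fun n : ℕ => ((Real.logb 2 K / n : ℝ) : EReal)) atTop (𝓝 0) :=
    continuous_coe_real_ereal.continuousAt.tendsto.comp (tendsto_const_div_atTop_nhds_zero_nat _)
  have hsum : Tendsto (fun n : ℕ => ((Real.logb 2 K / n : ℝ) : EReal) + regSeq ρ n) atTop
      (𝓝 R) := by
    have := (EReal.continuousAt_add (p := (0, R)) (by simp) (by simp)).tendsto.comp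
      (hK0.prodMk_nhds hR)
    simpa [Function.comp_def] using this
  refine le_of_tendsto_of_tendsto hL hsum ?_
  filter_upwards [eventually_ge_atTop 1] with n hn
  have hn' : (0 : ℝ) < 1 / n := by positivity
  set Ω := OmegaHat (Sep (Fin n → a) (Fin n → b)) (tensorPow ρ n)
  change -(((1 / n : ℝ) : EReal) * log2 (ε n)) ≤ _ + ((1 / n : ℝ) : EReal) * log2 Ω
  by_cases htop : Ω = ⊤
  · rw [htop, log2_top, EReal.coe_mul_top_of_pos hn', EReal.coe_add_top]
    exact le_top
  have hΩ1 : 1 ≤ Ω.toReal := by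
    simpa using ENNReal.toReal_mono htop (one_le_omegaHat (tensorPow ρ n))
  have hKε : 1 ≤ K * Ω.toReal * ε n := by
    have hc : Continuous fun x : ℝ => K * x * ε n := by fun_prop
    refine ge_of_tendsto (hc.continuousWithinAt (s := Set.Ioi Ω.toReal)).tendsto ?_
    filter_upwards [self_mem_nhdsWithin] with x hx
    have hlt : Ω < ENNReal.ofReal x := (ENNReal.lt_ofReal_iff_toReal_lt htop).2 hx
    obtain ⟨σ, hσ, γ, hγ, hs⟩ := sandwich_of_omegaHat_lt hlt
    have hx0 : 0 ≤ x := (zero_le_one.trans hΩ1).trans (le_of_lt hx)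
    have hγx : (γ : ℝ) ≤ x := by
      rw [← ENNReal.ofReal_coe_nnreal] at hγ
      exact (ENNReal.ofReal_le_ofReal_iff hx0).1 hγ.le
    refine ((hε n hn).one_le hδ hm hρ hσ hs).trans ?_
    gcongr
  have hεpos : (0 : ℝ) < ε n := by
    by_contra! h
    have : (ε n : ℝ) = 0 := le_antisymm h (ε n).2
    rw [this] at hKε
    linarith
  rw [← ENNReal.ofReal_toReal htop, ← ENNReal.ofReal_coe_nnreal, coe_mul_log2_ofReal n hεpos,
    coe_mul_log2_ofReal n (by linarith), ← EReal.coe_neg, ← EReal.coe_add, EReal.coe_le_coe_iff,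
    ← neg_div, ← add_div]
  gcongr
  have h1 := Real.logb_nonneg one_lt_two hKε
  rw [Real.logb_mul (by positivity) hεpos.ne', Real.logb_mul hK.ne' (by positivity)] at h1
  linarith

/-- Every real `L < R` is the exponent of the errors `C * 2 ^ (-L n)`, which are achievable for
large `n`. -/
lemma le_distExponentAt {ρ : Matrix (a × b) (a × b) ℂ} (hρ : IsState ρ) {δ : ℝ} (hδ : 0 ≤ δ) {m : ℕ}
    (hm : m ≠ 0) {R : EReal} (hR : Tendsto (regSeq ρ) atTop (𝓝 R)) : R ≤ distExponentAt δ m ρ := by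
  obtain ⟨C, hC, hdist⟩ := exists_distills (a := a) (b := b) hm hδ hρ
  refine le_of_forall_lt fun L' hL' => ?_
  obtain ⟨L, hL1, hL2⟩ := EReal.lt_iff_exists_real_btwn.1 hL'
  refine hL1.trans_le (le_sSup ?_)
  let Ω : ℕ → ℝ≥0∞ := fun n => OmegaHat (Sep (Fin n → a) (Fin n → b)) (tensorPow ρ n)
  let g : ℕ → ℝ≥0 := fun n => Real.toNNReal (2 ^ (L * n))
  have hg (n) : (g n : ℝ) = 2 ^ (L * n) := Real.coe_toNNReal _ (by positivity)
  have hgpos (n) : 0 < g n := by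
    rw [← NNReal.coe_pos, hg]
    positivity
  have hlog (n : ℕ) : Real.logb 2 (2 ^ (L * n)) = L * n := Real.logb_rpow two_pos (by norm_num)
  classical
  -- beyond some `n`, `2 ^ (L n) < Ω̂`; before that, `1 / 2 < 1 ≤ Ω̂` gives some finite error
  let γ : ℕ → ℝ≥0 := fun n => if (g n : ℝ≥0∞) < Ω n then g n else 1 / 2
  refine ⟨fun n => C / γ n, fun n _ => ?_, ?_⟩
  · by_cases h : (g n : ℝ≥0∞) < Ω n
    · simp only [γ, if_pos h]
      exact hdist n _ (hgpos n) h
    · simp only [γ, if_neg h]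
      refine hdist n _ (by norm_num) (lt_of_lt_of_le ?_ (one_le_omegaHat _))
      exact_mod_cast (by norm_num : (1 / 2 : ℝ≥0) < 1)
  · have hlim : Tendsto (fun n : ℕ => ((L - Real.logb 2 C / n : ℝ) : EReal)) atTop
        (𝓝 (L : EReal)) := by
      refine continuous_coe_real_ereal.continuousAt.tendsto.comp ?_
      simpa using tendsto_const_nhds.sub (tendsto_const_div_atTop_nhds_zero_nat (Real.logb 2 C))
    refine hlim.congr' ?_
    filter_upwards [hR.eventually_const_lt hL2, eventually_ge_atTop 1] with n hn hn1
    have hn0 : (0 : ℝ) < n := by exact_mod_cast hn1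
    have hlt : (g n : ℝ≥0∞) < Ω n := by
      by_contra! h
      refine absurd hn (not_lt.2 ?_)
      change ((1 / n : ℝ) : EReal) * log2 (Ω n) ≤ L
      have h1 := log2_mono h
      refine (mul_le_mul_of_nonneg_left h1
        (by exact_mod_cast (by positivity : 0 ≤ (1 / n : ℝ)))).trans ?_
      rw [← ENNReal.ofReal_coe_nnreal, hg, coe_mul_log2_ofReal n (by positivity), hlog,
        mul_div_cancel_right₀ _ hn0.ne']
    have hC' : (0 : ℝ) < C := hC
    simp only [γ, if_pos hlt]
    rw [← ENNReal.ofReal_coe_nnreal, NNReal.coe_div, hg, coe_mul_log2_ofReal n (by positivity),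
      Real.logb_div hC'.ne' (by positivity), hlog, ← EReal.coe_neg]
    congr 1
    field_simp
    ring

end Exponent
end ProbDistill
end

theorem theorem1 {a b : Type*} [Fintype a] [DecidableEq a] [Fintype b] [DecidableEq b]
    (ρ : Matrix (a × b) (a × b) ℂ) (hρ : ProbDistill.IsState ρ) (δ : ℝ) (hδ : 0 ≤ δ) :
    Tendsto (ProbDistill.regSeq ρ) atTop (𝓝 (ProbDistill.DOmegaHatReg ρ)) ∧
    (∀ m : ℕ, 2 ≤ m → ProbDistill.distExponentAt δ m ρ = ProbDistill.DOmegaHatReg ρ) ∧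
    Tendsto (fun m : ℕ => ProbDistill.distExponentAt δ m ρ) atTop
      (𝓝 (ProbDistill.distExponent δ ρ)) ∧
    ProbDistill.distExponent δ ρ = ProbDistill.DOmegaHatReg ρ := by
  obtain ⟨R, hR⟩ := ProbDistill.exists_tendsto_regSeq hρ
  have hreg : ProbDistill.DOmegaHatReg ρ = R := hR.limUnder_eq
  have hexp (m : ℕ) (hm : 2 ≤ m) : ProbDistill.distExponentAt δ m ρ = R :=
    le_antisymm (ProbDistill.distExponentAt_le hρ hδ hm hR)
      (ProbDistill.le_distExponentAt hρ hδ (by omega) hR)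
  have hlim : Tendsto (fun m : ℕ => ProbDistill.distExponentAt δ m ρ) atTop (𝓝 R) :=
    tendsto_const_nhds.congr' <| (eventually_ge_atTop 2).mono fun m hm => (hexp m hm).symm
  have hdist : ProbDistill.distExponent δ ρ = R := hlim.limUnder_eq
  rw [hreg, hdist]
  exact ⟨hR, hexp, hlim, rfl⟩
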